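/- Let $\mathbb K$ be an algebraically closed field of characteristic zero and let $A$ be a finite-dimensional $\mathbb K$-vector space. Definitions. A relative Poisson algebra $(A,\cdot,[-,-],P)$ consists of a commutative associative (not necessarily unital) product, a Lie bracket and a linear map $P$ that is a derivation of both, with $[z,x\cdot y]=[z,x]\cdot y+x\cdot[z,y]+x\cdot y\cdot P(z)$. A relative Poisson coalgebra $(A,\Delta,\delta,Q)$ consists of a cocommutative coassociative coproduct $\Delta$, a Lie cobracket $\delta$ and a linear map $Q$ with $\Delta Q=(Q\otimes\mathrm{id}+\mathrm{id}\otimes Q)\Delta$, $\delta Q=(Q\otimes\mathrm{id}+\mathrm{id}\otimes Q)\delta$ and $$(\mathrm{id}\otimes\Delta)\delta-(\delta\otimes\mathrm{id})\Delta-(\tau\otimes\mathrm{id})(\mathrm{id}\otimes\delta)\Delta-(Q\otimes\mathrm{id}\otimes\mathrm{id})(\Delta\otimes\mathrm{id})\Delta=0,$$ where $\tau(x\otimes y)=y\otimes x$. Write $\mathcal L(x)y=x\cdot y$ and $\mathrm{ad}(x)y=[x,y]$. A relative Poisson bialgebra $(A,\cdot,[-,-],\Delta,\delta,P,Q)$ is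 a relative Poisson algebra $(A,\cdot,[-,-],P)$ together with a relative Poisson coalgebra $(A,\Delta,\delta,Q)$ such that for all $x,y,z\in A$: * $\Delta(x\cdot y)=(\mathcal L(x)\otimes\mathrm{id})\Delta(y)+(\mathrm{id}\otimes\mathcal L(y))\Delta(x)$; * $\delta([x,y])=(\mathrm{ad}(x)\otimes\mathrm{id}+\mathrm{id}\otimes\mathrm{ad}(x))\delta(y)-(\mathrm{ad}(y)\otimes\mathrm{id}+\mathrm{id}\otimes\mathrm{ad}(y))\delta(x)$; * $x\cdot Q(y)-P(x)\cdot y-Q(x\cdot y)=0$, $[x,Q(y)]-[P(x),y]-Q([x,y])=0$, $(P+Q)(x\cdot y\cdot z)=0$; * $\Delta P=(P\otimes\mathrm{id}-\mathrm{id}\otimes Q)\Delta$, $\delta P=(P\otimes\mathrm{id}-\mathrm{id}\otimes Q)\delta$, $(\Delta\otimes\mathrm{id})\Delta(P+Q)=0$; * $\delta(x\cdot y)-(\mathrm{id}\otimes\mathrm{ad}(y))\Delta(x)-(\mathcal L(x)\otimes\mathrm{id})\delta(y)-(\mathrm{id}\otimes\mathrm{ad}(x))\Delta(y)-(\mathcal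 L(y)\otimes\mathrm{id})\delta(x)-(\mathrm{id}\otimes Q)\Delta(x\cdot y)=0$; * $\Delta([x,y])-(\mathcal L(y)\otimes\mathrm{id})\delta(x)-(\mathrm{id}\otimes\mathrm{ad}(x))\Delta(y)+(\mathrm{id}\otimes\mathcal L(y))\delta(x)-(\mathrm{ad}(x)\otimes\mathrm{id})\Delta(y)+\Delta(P(x)\cdot y)=0$. It is coboundary if there is $r\in A\otimes A$ with $\Delta(x)=(\mathrm{id}\otimes\mathcal L(x)-\mathcal L(x)\otimes\mathrm{id})r$ and $\delta(x)=(\mathrm{ad}(x)\otimes\mathrm{id}+\mathrm{id}\otimes\mathrm{ad}(x))r$ for all $x$; one then says that it is given by $r$. A sub-bialgebra is a subspace to which all six operations restrict, with the restricted operations. Theorem. Let $(A,\cdot_A,[-,-]_A,\Delta_A,\delta_A,P,Q)$ be a relative Poisson bialgebra. Equip $A^*$ with the operations $a^*\cdot_{A^*}b^*=\Delta_A^*(a^*\otimes b^*)$, $[a^*,b^*]_{A^*}=\delta_A^*(a^*\otimes b^*)$, $\langle\Delta_{A^*}(a^*),x\otimes y\rangle=-\langle a^*,x\cdot_A y\rangle$,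 $\langle\delta_{A^*}(a^*),x\otimes y\rangle=-\langle a^*,[x,y]_A\rangle$. Then $(A^*,\cdot_{A^*},[-,-]_{A^*},\Delta_{A^*},\delta_{A^*},Q^*,P^*)$ is a relative Poisson bialgebra. Moreover, there is a coboundary relative Poisson bialgebra structure on $A\oplus A^*$, with derivation $P+Q^*$ (the map $x+a^*\mapsto P(x)+Q^*(a^*)$) in the role of $P$ and with $Q+P^*$ in the role of $Q$, whose product and bracket are those of the double $A\bowtie A^*$: they extend the operations of $A$ and of $A^*$, and for $x\in A$, $a^*\in A^*$ $$x\cdot a^*=-\mathcal L_A^*(x)a^*-\mathcal L_{A^*}^*(a^*)x,\qquad [x,a^*]=\mathrm{ad}_A^*(x)a^*-\mathrm{ad}_{A^*}^*(a^*)x,$$ where, for $\varphi:B\to\mathrm{End}(V)$, the map $\varphi^*:B\to\mathrm{End}(V^*)$ is defined by $\langle\varphi^*(b)u^*,v\rangle=-\langle u^*,\varphi(b)v\rangle$, and $A^{**}=A$. This structure is given by $r=\sum_i e_i\otimes e_i^*$ for every basis $(e_i)$ of $A$ with dual basis $(e_i^*)$, and it contains the above relative Poisson bialgebras $A$ and $A^*$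 as relative Poisson sub-bialgebras. -/

import Mathlib

open scoped TensorProduct

set_option maxSynthPendingDepth 3

namespace RelPoisson

section Algebras

variable {K A : Type*} [Field K] [AddCommGroup A] [Module K A]

/-- `mul` is a (not necessarily unital) commutative associative product. -/
structure IsCommAssocAlgebra (mul : A →ₗ[K] A →ₗ[K] A) : Prop where
  comm : ∀ x y, mul x y = mul y x
  assoc : ∀ x y z, mul (mul x y) z = mul x (mul y z)

/-- `br` is a Lie bracket. -/
structure IsLieAlgebra (br : A →ₗ[K] A →ₗ[K] A) : Prop where
  self : ∀ x, br x x = 0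
  jacobi : ∀ x y z, br x (br y z) + br y (br z x) + br z (br x y) = 0

/-- `(A, mul, br, P)` is a relative Poisson algebra. -/
structure IsRelativePoissonAlgebra (mul br : A →ₗ[K] A →ₗ[K] A) (P : A →ₗ[K] A) : Prop where
  commAssoc : IsCommAssocAlgebra mul
  lie : IsLieAlgebra br
  map_mul : ∀ x y, P (mul x y) = mul (P x) y + mul x (P y)
  map_br : ∀ x y, P (br x y) = br (P x) y + br x (P y)
  leibniz : ∀ x y z,
    br z (mul x y) = mul (br z x) y + mul x (br z y) + mul (mul x y) (P z)

/-- The flip `τ (x ⊗ y) = y ⊗ x`. -/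
def flip : A ⊗[K] A →ₗ[K] A ⊗[K] A := (TensorProduct.comm K A A).toLinearMap

/-- The cyclic permutation `ξ (x ⊗ y ⊗ z) = y ⊗ z ⊗ x`.
Triple tensors are always bracketed as `A ⊗ (A ⊗ A)`. -/
def cyc : A ⊗[K] (A ⊗[K] A) →ₗ[K] A ⊗[K] (A ⊗[K] A) :=
  (TensorProduct.assoc K A A A).toLinearMap ∘ₗ (TensorProduct.comm K A (A ⊗[K] A)).toLinearMap

/-- `τ ⊗ id : x ⊗ y ⊗ z ↦ y ⊗ x ⊗ z`. -/
def flipLeft : A ⊗[K] (A ⊗[K] A) →ₗ[K] A ⊗[K] (A ⊗[K] A) :=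
  (TensorProduct.leftComm K A A A).toLinearMap

/-- `(f ⊗ id) : A ⊗ A → A ⊗ A ⊗ A` for `f : A → A ⊗ A`. -/
def applyLeft (f : A →ₗ[K] A ⊗[K] A) : A ⊗[K] A →ₗ[K] A ⊗[K] (A ⊗[K] A) :=
  (TensorProduct.assoc K A A A).toLinearMap ∘ₗ f.rTensor A

/-- `(id ⊗ f) : A ⊗ A → A ⊗ A ⊗ A` for `f : A → A ⊗ A`. -/
def applyRight (f : A →ₗ[K] A ⊗[K] A) : A ⊗[K] A →ₗ[K] A ⊗[K] (A ⊗[K] A) :=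
  f.lTensor A

/-- `(A, Δ)` is a cocommutative coassociative coalgebra (no counit). -/
structure IsCocommCoassocCoalgebra (Δ : A →ₗ[K] A ⊗[K] A) : Prop where
  cocomm : ∀ x, flip (Δ x) = Δ x
  coassoc : ∀ x, applyRight Δ (Δ x) = applyLeft Δ (Δ x)

/-- `(A, δ)` is a Lie coalgebra. -/
structure IsLieCoalgebra (δ : A →ₗ[K] A ⊗[K] A) : Prop where
  antisymm : ∀ x, flip (δ x) = -δ x
  cojacobi : ∀ x, applyRight δ (δ x) + cyc (applyRight δ (δ x))
    + cyc (cyc (applyRight δ (δ x))) = 0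

/-- `(A, Δ, δ, Q)` is a relative Poisson coalgebra. -/
structure IsRelativePoissonCoalgebra (Δ δ : A →ₗ[K] A ⊗[K] A) (Q : A →ₗ[K] A) : Prop where
  cocommCoassoc : IsCocommCoassocCoalgebra Δ
  lieCo : IsLieCoalgebra δ
  comul_map : ∀ x, Δ (Q x) = Q.rTensor A (Δ x) + Q.lTensor A (Δ x)
  cobr_map : ∀ x, δ (Q x) = Q.rTensor A (δ x) + Q.lTensor A (δ x)
  coleibniz : ∀ x, applyRight Δ (δ x) - applyLeft δ (Δ x) - flipLeft (applyRight δ (Δ x))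
    - Q.rTensor (A ⊗[K] A) (applyLeft Δ (Δ x)) = 0

/-- `Q` dually represents the relative Poisson algebra `(A, mul, br, P)`. -/
structure DuallyRepresents (mul br : A →ₗ[K] A →ₗ[K] A) (P Q : A →ₗ[K] A) : Prop where
  mul_map : ∀ x y, mul x (Q y) - mul (P x) y - Q (mul x y) = 0
  br_map : ∀ x y, br x (Q y) - br (P x) y - Q (br x y) = 0
  add_map : ∀ x y z, (P + Q) (mul (mul x y) z) = 0

/-- `P*` dually represents `(A*, Q*)`, written on the coalgebra `(A, Δ, δ, Q)`. -/
structure CoDuallyRepresents (Δ δ : A →ₗ[K] A ⊗[K] A) (P Q : A →ₗ[K] A) : Prop where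
  comul_map : ∀ x, Δ (P x) = P.rTensor A (Δ x) - Q.lTensor A (Δ x)
  cobr_map : ∀ x, δ (P x) = P.rTensor A (δ x) - Q.lTensor A (δ x)
  add_map : ∀ x, applyLeft Δ (Δ ((P + Q) x)) = 0

variable (K A) in
/-- The operations `(·, [-,-], Δ, δ, P, Q)` of a (candidate) relative Poisson bialgebra;
the axioms are in `IsRelativePoissonBialgebra`. -/
structure Operations where
  /-- the product -/
  mul : A →ₗ[K] A →ₗ[K] A
  /-- the bracket -/
  br : A →ₗ[K] A →ₗ[K] A
  /-- the coproduct -/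
  Δ : A →ₗ[K] A ⊗[K] A
  /-- the cobracket -/
  δ : A →ₗ[K] A ⊗[K] A
  /-- the derivation -/
  P : A →ₗ[K] A
  /-- the coderivation -/
  Q : A →ₗ[K] A

/-- `(A, ·, [-,-], Δ, δ, P, Q)` is a relative Poisson bialgebra. -/
structure IsRelativePoissonBialgebra (S : Operations K A) : Prop where
  algebra : IsRelativePoissonAlgebra S.mul S.br S.P
  coalgebra : IsRelativePoissonCoalgebra S.Δ S.δ S.Q
  /-- the infinitesimal bialgebra condition -/
  comul_mul : ∀ x y, S.Δ (S.mul x y)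
    = (S.mul x).rTensor A (S.Δ y) + (S.mul y).lTensor A (S.Δ x)
  /-- the Lie bialgebra (1-cocycle) condition -/
  cobr_br : ∀ x y, S.δ (S.br x y)
    = ((S.br x).rTensor A (S.δ y) + (S.br x).lTensor A (S.δ y))
      - ((S.br y).rTensor A (S.δ x) + (S.br y).lTensor A (S.δ x))
  duallyRepresents : DuallyRepresents S.mul S.br S.P S.Q
  coDuallyRepresents : CoDuallyRepresents S.Δ S.δ S.P S.Q
  cobr_mul : ∀ x y, S.δ (S.mul x y)
      - (S.br y).lTensor A (S.Δ x) - (S.mul x).rTensor A (S.δ y)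
      - (S.br x).lTensor A (S.Δ y) - (S.mul y).rTensor A (S.δ x)
      - S.Q.lTensor A (S.Δ (S.mul x y)) = 0
  comul_br : ∀ x y, S.Δ (S.br x y)
      - (S.mul y).rTensor A (S.δ x) - (S.br x).lTensor A (S.Δ y)
      + (S.mul y).lTensor A (S.δ x) - (S.br x).rTensor A (S.Δ y)
      + S.Δ (S.mul (S.P x) y) = 0

/-- The coproduct and the cobracket are the coboundaries of `r`:
`Δ x = (id ⊗ L(x) - L(x) ⊗ id) r` and `δ x = (ad(x) ⊗ id + id ⊗ ad(x)) r`. -/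
structure IsCoboundaryOf (S : Operations K A) (r : A ⊗[K] A) : Prop where
  comul_eq : ∀ x, S.Δ x = (S.mul x).lTensor A r - (S.mul x).rTensor A r
  cobr_eq : ∀ x, S.δ x = (S.br x).rTensor A r + (S.br x).lTensor A r

/-- `S` is a coboundary relative Poisson bialgebra. -/
structure IsCoboundaryRelativePoissonBialgebra (S : Operations K A) : Prop where
  bialgebra : IsRelativePoissonBialgebra S
  coboundary : ∃ r : A ⊗[K] A, IsCoboundaryOf S r

/-- The injective linear map `i : B → A` identifies `T` on `B` with a sub-bialgebra of `S` on `A`: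
all operations of `S` restrict to the image of `i`, and the restrictions are those of `T`. -/
structure IsSubBialgebra {B : Type*} [AddCommGroup B] [Module K B]
    (T : Operations K B) (S : Operations K A) (i : B →ₗ[K] A) : Prop where
  injective : Function.Injective i
  mul_eq : ∀ x y, S.mul (i x) (i y) = i (T.mul x y)
  br_eq : ∀ x y, S.br (i x) (i y) = i (T.br x y)
  comul_eq : ∀ x, S.Δ (i x) = TensorProduct.map i i (T.Δ x)
  cobr_eq : ∀ x, S.δ (i x) = TensorProduct.map i i (T.δ x)
  derivation_eq : ∀ x, S.P (i x) = i (T.P x)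
  coderivation_eq : ∀ x, S.Q (i x) = i (T.Q x)

end Algebras

section Dual

variable {K A : Type*} [Field K] [AddCommGroup A] [Module K A]

/-- The bilinear operation on `A*` dual to `Δ : A → A ⊗ A`: `⟨a* b*, x⟩ = ⟨a* ⊗ b*, Δ x⟩`. -/
def dualOp (Δ : A →ₗ[K] A ⊗[K] A) :
    Module.Dual K A →ₗ[K] Module.Dual K A →ₗ[K] Module.Dual K A :=
  (TensorProduct.mk K (Module.Dual K A) (Module.Dual K A)).compr₂
    (Δ.dualMap ∘ₗ TensorProduct.dualDistrib K A A)

/-- The cooperation on `A*` with `⟨Δ a*, x ⊗ y⟩ = -⟨a*, m x y⟩`; note the sign. -/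
noncomputable def dualCoop [FiniteDimensional K A] (m : A →ₗ[K] A →ₗ[K] A) :
    Module.Dual K A →ₗ[K] Module.Dual K A ⊗[K] Module.Dual K A :=
  -((TensorProduct.dualDistribEquiv K A A).symm.toLinearMap ∘ₗ (TensorProduct.lift m).dualMap)

/-- The operations on `A*` dual to those on `A`, with derivation `Q*` and coderivation `P*`. -/
noncomputable def Operations.dual [FiniteDimensional K A] (S : Operations K A) :
    Operations K (Module.Dual K A) where
  mul := dualOp S.Δ
  br := dualOp S.δ
  Δ := dualCoop S.mul
  δ := dualCoop S.br
  P := S.Q.dualMap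
  Q := S.P.dualMap

/-- For `φ : B → End V`, the map `φ* : B → End V*` with `⟨φ*(x) u*, v⟩ = -⟨u*, φ(x) v⟩`. -/
def coact {B V : Type*} [AddCommGroup B] [Module K B] [AddCommGroup V] [Module K V]
    (φ : B →ₗ[K] V →ₗ[K] V) : B →ₗ[K] Module.Dual K V →ₗ[K] Module.Dual K V :=
  -(Module.Dual.transpose ∘ₗ φ)

/-- For `φ : B → End V*`, the map `φ* : B → End V** = End V`, with
`⟨u*, φ*(x) v⟩ = -⟨φ(x) u*, v⟩`. -/
noncomputable def coactDual {B V : Type*} [AddCommGroup B] [Module K B] [AddCommGroup V]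
    [Module K V] [FiniteDimensional K V]
    (φ : B →ₗ[K] Module.Dual K V →ₗ[K] Module.Dual K V) : B →ₗ[K] V →ₗ[K] V :=
  (Module.evalEquiv K V).symm.conj.toLinearMap ∘ₗ coact φ

/-- The product of a matched pair:
`(x + a)(y + b) = xy + μ₂(a)y + μ₂(b)x + ab + μ₁(x)b + μ₁(y)a`. -/
def matchedMul {A₁ A₂ : Type*} [AddCommGroup A₁] [Module K A₁] [AddCommGroup A₂] [Module K A₂]
    (m₁ : A₁ →ₗ[K] A₁ →ₗ[K] A₁) (m₂ : A₂ →ₗ[K] A₂ →ₗ[K] A₂)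
    (μ₁ : A₁ →ₗ[K] A₂ →ₗ[K] A₂) (μ₂ : A₂ →ₗ[K] A₁ →ₗ[K] A₁) :
    (A₁ × A₂) →ₗ[K] (A₁ × A₂) →ₗ[K] (A₁ × A₂) :=
  LinearMap.mk₂ K
    (fun u v => (m₁ u.1 v.1 + μ₂ u.2 v.1 + μ₂ v.2 u.1, m₂ u.2 v.2 + μ₁ u.1 v.2 + μ₁ v.1 u.2))
    (fun u u' v => by ext <;> simp <;> abel)
    (fun c u v => by ext <;> simp)
    (fun u v v' => by ext <;> simp <;> abel)
    (fun c u v => by ext <;> simp)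

/-- The bracket of a matched pair:
`[x + a, y + b] = [x,y] + ρ₂(a)y - ρ₂(b)x + [a,b] + ρ₁(x)b - ρ₁(y)a`. -/
def matchedBr {A₁ A₂ : Type*} [AddCommGroup A₁] [Module K A₁] [AddCommGroup A₂] [Module K A₂]
    (b₁ : A₁ →ₗ[K] A₁ →ₗ[K] A₁) (b₂ : A₂ →ₗ[K] A₂ →ₗ[K] A₂)
    (ρ₁ : A₁ →ₗ[K] A₂ →ₗ[K] A₂) (ρ₂ : A₂ →ₗ[K] A₁ →ₗ[K] A₁) :
    (A₁ × A₂) →ₗ[K] (A₁ × A₂) →ₗ[K] (A₁ × A₂) :=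
  LinearMap.mk₂ K
    (fun u v => (b₁ u.1 v.1 + ρ₂ u.2 v.1 - ρ₂ v.2 u.1, b₂ u.2 v.2 + ρ₁ u.1 v.2 - ρ₁ v.1 u.2))
    (fun u u' v => by ext <;> simp <;> abel)
    (fun c u v => by ext <;> simp [smul_sub])
    (fun u v v' => by ext <;> simp <;> abel)
    (fun c u v => by ext <;> simp [smul_sub])

variable [FiniteDimensional K A]

/-- The product of `A ⋈ A*`, the matched pair product for `-L_A*` and `-L_{A*}*`. -/
noncomputable def Operations.doubleMul (S : Operations K A) :
    (A × Module.Dual K A) →ₗ[K] (A × Module.Dual K A) →ₗ[K] (A × Module.Dual K A) :=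
  matchedMul S.mul S.dual.mul (-coact S.mul) (-coactDual S.dual.mul)

/-- The bracket of `A ⋈ A*`, the matched pair bracket for `ad_A*` and `ad_{A*}*`. -/
noncomputable def Operations.doubleBr (S : Operations K A) :
    (A × Module.Dual K A) →ₗ[K] (A × Module.Dual K A) →ₗ[K] (A × Module.Dual K A) :=
  matchedBr S.br S.dual.br (coact S.br) (coactDual S.dual.br)

/-- The element `∑ eᵢ ⊗ eᵢ*` of `(A ⊕ A*) ⊗ (A ⊕ A*)`, for a basis `e` of `A`. -/
noncomputable def basisTensor {n : ℕ} (e : Module.Basis (Fin n) K A) :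
    (A × Module.Dual K A) ⊗[K] (A × Module.Dual K A) :=
  ∑ i, ((e i, 0) : A × Module.Dual K A) ⊗ₜ[K] ((0, e.coord i) : A × Module.Dual K A)

end Dual

end RelPoisson

/-! In finite dimension a tensor is determined by its pairings with products of functionals, so
every coalgebra axiom on `A` is an algebra axiom on `A*` and conversely. The bialgebra axioms then
turn out to be self-dual: the infinitesimal and the cocycle conditions are each their own dual,
while `cobr_mul` and `comul_br` are exchanged. Hence `A*` is a bialgebra.

The double is given, as a coalgebra, the direct sum of `A` and `A*`, so its coalgebra axioms come
from the two summands. Pairing with the canonical element `r` shows that this coproduct and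
cobracket are the coboundaries of `r`; no Yang–Baxter equation has to be checked.

The algebra axioms use the form `⟨b, x⟩ + ⟨a, y⟩` on `A ⊕ A*`, which is invariant and makes `Q + P*`
the adjoint of `P + Q*`. Each axiom becomes an identity between multilinear forms. Its components,
sorted by which arguments lie in `A` and which in `A*`, are axioms of `A` and of `A*` or bialgebra
conditions (`double_mul_assoc`, `double_br_jacobi`, `double_leibniz`).

The dual representation conditions follow from the invariant form. The remaining compatibilities are
operator identities applied to `r`, given `(P ⊗ id) r = (id ⊗ Q) r`
(`IsCoboundaryOf.isRelativePoissonBialgebra`). -/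

namespace RelPoisson

/-! ### Testing tensors against products of functionals. -/

section Pairings

variable {K V : Type*} [Field K] [AddCommGroup V] [Module K V]

/-- The functional `φ ⊗ ψ` on `V ⊗ V`. -/
def pair₂ (φ ψ : Module.Dual K V) : V ⊗[K] V →ₗ[K] K :=
  TensorProduct.dualDistrib K V V (φ ⊗ₜ ψ)

/-- The functional `φ ⊗ ψ ⊗ χ` on `V ⊗ V ⊗ V`. -/
def pair₃ (φ ψ χ : Module.Dual K V) : V ⊗[K] (V ⊗[K] V) →ₗ[K] K :=
  TensorProduct.dualDistrib K V (V ⊗[K] V) (φ ⊗ₜ pair₂ ψ χ)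

@[simp] lemma pair₂_tmul (φ ψ : Module.Dual K V) (x y : V) :
    pair₂ φ ψ (x ⊗ₜ y) = φ x * ψ y := rfl

@[simp] lemma pair₃_tmul (φ ψ χ : Module.Dual K V) (x : V) (t : V ⊗[K] V) :
    pair₃ φ ψ χ (x ⊗ₜ t) = φ x * pair₂ ψ χ t := rfl

lemma dualOp_apply (Δ : V →ₗ[K] V ⊗[K] V) (φ ψ : Module.Dual K V) (x : V) :
    dualOp Δ φ ψ x = pair₂ φ ψ (Δ x) := rfl

/-- Finite dimension makes the products `φ ⊗ ψ` span the dual of `V ⊗ V`. -/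
lemma tensor_ext [FiniteDimensional K V] {s t : V ⊗[K] V}
    (h : ∀ φ ψ, pair₂ φ ψ s = pair₂ φ ψ t) : s = t := by
  rw [← sub_eq_zero, ← Module.forall_dual_apply_eq_zero_iff K]
  intro f
  obtain ⟨g, rfl⟩ := (TensorProduct.dualDistribEquiv K V V).surjective f
  induction g using TensorProduct.induction_on with
  | zero => simp
  | tmul φ ψ => rw [map_sub, sub_eq_zero]; exact h φ ψ
  | add g₁ g₂ h₁ h₂ => rw [map_add, LinearMap.add_apply, h₁, h₂, add_zero]

lemma tensor_ext₃ [FiniteDimensional K V] {s t : V ⊗[K] (V ⊗[K] V)}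
    (h : ∀ φ ψ χ, pair₃ φ ψ χ s = pair₃ φ ψ χ t) : s = t := by
  rw [← sub_eq_zero, ← Module.forall_dual_apply_eq_zero_iff K]
  intro f
  obtain ⟨g, rfl⟩ := (TensorProduct.dualDistribEquiv K V (V ⊗[K] V)).surjective f
  induction g using TensorProduct.induction_on with
  | zero => simp
  | tmul φ f' =>
    obtain ⟨g', rfl⟩ := (TensorProduct.dualDistribEquiv K V V).surjective f'
    induction g' using TensorProduct.induction_on with
    | zero => simp
    | tmul ψ χ => rw [map_sub, sub_eq_zero]; exact h φ ψ χ
    | add g₁ g₂ h₁ h₂ =>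
      rw [map_add, TensorProduct.tmul_add, map_add, LinearMap.add_apply, h₁, h₂, add_zero]
  | add g₁ g₂ h₁ h₂ => rw [map_add, LinearMap.add_apply, h₁, h₂, add_zero]

lemma pair₂_flip (φ ψ : Module.Dual K V) (t : V ⊗[K] V) :
    pair₂ φ ψ (flip t) = pair₂ ψ φ t := by
  induction t using TensorProduct.induction_on with
  | zero => simp
  | tmul x y => simp [flip, mul_comm]
  | add s t hs ht => simp [hs, ht]

lemma pair₂_rTensor (φ ψ : Module.Dual K V) (f : V →ₗ[K] V) (t : V ⊗[K] V) :
    pair₂ φ ψ (f.rTensor V t) = pair₂ (f.dualMap φ) ψ t := by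
  induction t using TensorProduct.induction_on with
  | zero => simp
  | tmul x y => simp
  | add s t hs ht => simp [hs, ht]

lemma pair₂_lTensor (φ ψ : Module.Dual K V) (f : V →ₗ[K] V) (t : V ⊗[K] V) :
    pair₂ φ ψ (f.lTensor V t) = pair₂ φ (f.dualMap ψ) t := by
  induction t using TensorProduct.induction_on with
  | zero => simp
  | tmul x y => simp
  | add s t hs ht => simp [hs, ht]

lemma pair₃_rTensor (φ ψ χ : Module.Dual K V) (f : V →ₗ[K] V) (t : V ⊗[K] (V ⊗[K] V)) :
    pair₃ φ ψ χ (f.rTensor (V ⊗[K] V) t) = pair₃ (f.dualMap φ) ψ χ t := by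
  induction t using TensorProduct.induction_on with
  | zero => simp
  | tmul x y => simp
  | add s t hs ht => simp [hs, ht]

lemma pair₃_assoc_tmul (φ ψ χ : Module.Dual K V) (s : V ⊗[K] V) (z : V) :
    pair₃ φ ψ χ (TensorProduct.assoc K V V V (s ⊗ₜ z)) = pair₂ φ ψ s * χ z := by
  induction s using TensorProduct.induction_on with
  | zero => simp
  | tmul x y => simp [mul_assoc]
  | add s t hs ht => simp [TensorProduct.add_tmul, add_mul, hs, ht]

lemma pair₃_cyc (φ ψ χ : Module.Dual K V) (t : V ⊗[K] (V ⊗[K] V)) :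
    pair₃ φ ψ χ (cyc t) = pair₃ χ φ ψ t := by
  induction t using TensorProduct.induction_on with
  | zero => simp
  | tmul x s => simp [cyc, pair₃_assoc_tmul, mul_comm]
  | add s t hs ht => simp [hs, ht]

lemma pair₃_flipLeft (φ ψ χ : Module.Dual K V) (t : V ⊗[K] (V ⊗[K] V)) :
    pair₃ φ ψ χ (flipLeft t) = pair₃ ψ φ χ t := by
  induction t using TensorProduct.induction_on with
  | zero => simp
  | tmul x s =>
    induction s using TensorProduct.induction_on with
    | zero => simp
    | tmul y z => simp [flipLeft, mul_left_comm]
    | add s t hs ht => simp only [TensorProduct.tmul_add, map_add, hs, ht]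
  | add s t hs ht => simp [hs, ht]

/-- With `pair₃_applyLeft`, this turns iterated cooperations into iterated products of functionals,
so coassociativity, co-Jacobi and co-Leibniz become the usual axioms. -/
lemma pair₃_applyRight (φ ψ χ : Module.Dual K V) (Δ : V →ₗ[K] V ⊗[K] V) (t : V ⊗[K] V) :
    pair₃ φ ψ χ (applyRight Δ t) = pair₂ φ (dualOp Δ ψ χ) t := by
  induction t using TensorProduct.induction_on with
  | zero => simp
  | tmul x y => simp [applyRight, dualOp_apply]
  | add s t hs ht => simp [hs, ht]

lemma pair₃_applyLeft (φ ψ χ : Module.Dual K V) (Δ : V →ₗ[K] V ⊗[K] V) (t : V ⊗[K] V) :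
    pair₃ φ ψ χ (applyLeft Δ t) = pair₂ (dualOp Δ φ ψ) χ t := by
  induction t using TensorProduct.induction_on with
  | zero => simp
  | tmul x y => simp [applyLeft, dualOp_apply, pair₃_assoc_tmul]
  | add s t hs ht => simp [hs, ht]

end Pairings

/-! ### Relative Poisson coalgebras as algebras on the dual. -/

section Duality

variable {K V : Type*} [Field K] [AddCommGroup V] [Module K V]

lemma IsLieAlgebra.skew {br : V →ₗ[K] V →ₗ[K] V} (h : IsLieAlgebra br) (x y : V) :
    br x y = -br y x := by
  have := h.self (x + y)
  simp only [map_add, LinearMap.add_apply, h.self, zero_add, add_zero] at this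
  exact eq_neg_of_add_eq_zero_right this

/-- The operations dual to a relative Poisson coalgebra form a relative Poisson algebra. -/
lemma IsRelativePoissonCoalgebra.dual [CharZero K] {Δ δ : V →ₗ[K] V ⊗[K] V} {Q : V →ₗ[K] V}
    (h : IsRelativePoissonCoalgebra Δ δ Q) :
    IsRelativePoissonAlgebra (dualOp Δ) (dualOp δ) Q.dualMap := by
  have comm (φ ψ : Module.Dual K V) : dualOp Δ φ ψ = dualOp Δ ψ φ := by
    ext x
    rw [dualOp_apply, ← h.cocommCoassoc.cocomm x, pair₂_flip, dualOp_apply]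
  have skew (φ ψ : Module.Dual K V) : dualOp δ φ ψ = -dualOp δ ψ φ := by
    ext x
    rw [LinearMap.neg_apply, dualOp_apply, dualOp_apply, ← pair₂_flip φ ψ,
      h.lieCo.antisymm x, map_neg, neg_neg]
  have assoc (φ ψ χ : Module.Dual K V) :
      dualOp Δ (dualOp Δ φ ψ) χ = dualOp Δ φ (dualOp Δ ψ χ) := by
    ext x
    rw [dualOp_apply, dualOp_apply, ← pair₃_applyLeft, ← pair₃_applyRight,
      h.cocommCoassoc.coassoc]
  refine ⟨⟨comm, assoc⟩, ⟨fun φ => ?_, fun φ ψ χ => ?_⟩, fun φ ψ => ?_, fun φ ψ => ?_,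
    fun φ ψ χ => ?_⟩
  · ext x
    have := DFunLike.congr_fun (skew φ φ) x
    -- Antisymmetry gives `[φ, φ] = 0` only because 2 is invertible.
    exact self_eq_neg.mp this
  · ext x
    have := congrArg (pair₃ φ ψ χ) (h.lieCo.cojacobi x)
    simp only [map_add, pair₃_cyc, pair₃_applyRight, map_zero] at this
    simp only [LinearMap.add_apply, dualOp_apply δ, LinearMap.zero_apply]
    linear_combination this
  · ext x
    have := congrArg (pair₂ φ ψ) (h.comul_map x)
    rwa [map_add, pair₂_rTensor, pair₂_lTensor] at this
  · ext x
    have := congrArg (pair₂ φ ψ) (h.cobr_map x)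
    rwa [map_add, pair₂_rTensor, pair₂_lTensor] at this
  -- The co-Leibniz rule has `Q` on the first leg, the Leibniz rule has it on the last factor.
  · have e : dualOp Δ (dualOp Δ φ ψ) (Q.dualMap χ) = dualOp Δ (dualOp Δ (Q.dualMap χ) φ) ψ := by
      rw [comm, assoc]
    ext x
    have := congrArg (pair₃ χ φ ψ) (h.coleibniz x)
    simp only [map_sub, pair₃_flipLeft, pair₃_applyRight, pair₃_applyLeft, pair₃_rTensor,
      map_zero] at this
    rw [e]
    simp only [LinearMap.add_apply, dualOp_apply Δ _ ψ, dualOp_apply δ _ (dualOp Δ φ ψ),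
      dualOp_apply Δ φ (dualOp δ χ ψ)]
    linear_combination this

/-- A triple whose dual is a relative Poisson algebra is a relative Poisson coalgebra. -/
lemma IsRelativePoissonCoalgebra.of_dual [FiniteDimensional K V]
    {Δ δ : V →ₗ[K] V ⊗[K] V} {Q : V →ₗ[K] V}
    (h : IsRelativePoissonAlgebra (dualOp Δ) (dualOp δ) Q.dualMap) :
    IsRelativePoissonCoalgebra Δ δ Q := by
  refine ⟨⟨fun x => tensor_ext fun φ ψ => ?_, fun x => tensor_ext₃ fun φ ψ χ => ?_⟩,
    ⟨fun x => tensor_ext fun φ ψ => ?_, fun x => tensor_ext₃ fun φ ψ χ => ?_⟩,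
    fun x => tensor_ext fun φ ψ => ?_, fun x => tensor_ext fun φ ψ => ?_,
    fun x => tensor_ext₃ fun φ ψ χ => ?_⟩
  · rw [pair₂_flip]
    exact DFunLike.congr_fun (h.commAssoc.comm ψ φ) x
  · rw [pair₃_applyRight, pair₃_applyLeft]
    exact (DFunLike.congr_fun (h.commAssoc.assoc φ ψ χ) x).symm
  · rw [pair₂_flip, map_neg]
    exact DFunLike.congr_fun (h.lie.skew ψ φ) x
  · have := DFunLike.congr_fun (h.lie.jacobi φ ψ χ) x
    simp only [LinearMap.add_apply, dualOp_apply δ, LinearMap.zero_apply] at this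
    simp only [map_add, pair₃_cyc, pair₃_applyRight, map_zero]
    linear_combination this
  · simp only [map_add, pair₂_rTensor, pair₂_lTensor]
    exact DFunLike.congr_fun (h.map_mul φ ψ) x
  · simp only [map_add, pair₂_rTensor, pair₂_lTensor]
    exact DFunLike.congr_fun (h.map_br φ ψ) x
  · have e : dualOp Δ (dualOp Δ ψ χ) (Q.dualMap φ) = dualOp Δ (dualOp Δ (Q.dualMap φ) ψ) χ := by
      rw [h.commAssoc.comm, h.commAssoc.assoc]
    have := DFunLike.congr_fun (h.leibniz ψ χ φ) x
    rw [e] at this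
    simp only [LinearMap.add_apply, dualOp_apply Δ _ χ, dualOp_apply δ _ (dualOp Δ ψ χ),
      dualOp_apply Δ ψ (dualOp δ φ χ)] at this
    simp only [map_sub, pair₃_flipLeft, pair₃_applyRight, pair₃_applyLeft, pair₃_rTensor,
      map_zero]
    linear_combination this

end Duality

/-! ### The mixed bialgebra conditions as scalar identities. -/

section Scalar

variable {K A : Type*} [Field K] [AddCommGroup A] [Module K A] {S : Operations K A}

lemma IsRelativePoissonBialgebra.pair_comul_mul (h : IsRelativePoissonBialgebra S)
    (a b : Module.Dual K A) (x y : A) :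
    dualOp S.Δ a b (S.mul x y) =
      dualOp S.Δ ((S.mul x).dualMap a) b y + dualOp S.Δ a ((S.mul y).dualMap b) x := by
  rw [dualOp_apply, h.comul_mul, map_add, pair₂_rTensor, pair₂_lTensor]; rfl

lemma IsRelativePoissonBialgebra.pair_cobr_br (h : IsRelativePoissonBialgebra S)
    (a b : Module.Dual K A) (x y : A) :
    dualOp S.δ a b (S.br x y) =
      dualOp S.δ ((S.br x).dualMap a) b y + dualOp S.δ a ((S.br x).dualMap b) y
      - (dualOp S.δ ((S.br y).dualMap a) b x + dualOp S.δ a ((S.br y).dualMap b) x) := by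
  rw [dualOp_apply, h.cobr_br]
  simp only [map_sub, map_add, pair₂_rTensor, pair₂_lTensor]; rfl

lemma IsRelativePoissonBialgebra.pair_cobr_mul (h : IsRelativePoissonBialgebra S)
    (a b : Module.Dual K A) (x y : A) :
    dualOp S.δ a b (S.mul x y) - dualOp S.Δ a ((S.br y).dualMap b) x
      - dualOp S.δ ((S.mul x).dualMap a) b y - dualOp S.Δ a ((S.br x).dualMap b) y
      - dualOp S.δ ((S.mul y).dualMap a) b x
      - dualOp S.Δ a (S.Q.dualMap b) (S.mul x y) = 0 := by
  have := congrArg (pair₂ a b) (h.cobr_mul x y)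
  simp only [map_sub, pair₂_rTensor, pair₂_lTensor, map_zero] at this
  exact this

lemma IsRelativePoissonBialgebra.pair_comul_br (h : IsRelativePoissonBialgebra S)
    (a b : Module.Dual K A) (x y : A) :
    dualOp S.Δ a b (S.br x y) - dualOp S.δ ((S.mul y).dualMap a) b x
      - dualOp S.Δ a ((S.br x).dualMap b) y + dualOp S.δ a ((S.mul y).dualMap b) x
      - dualOp S.Δ ((S.br x).dualMap a) b y + dualOp S.Δ a b (S.mul (S.P x) y) = 0 := by
  have := congrArg (pair₂ a b) (h.comul_br x y)
  simp only [map_sub, map_add, pair₂_rTensor, pair₂_lTensor, map_zero] at this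
  exact this

end Scalar

/-! ### Identifying `A**` with `A`. -/

section DoubleDual

variable {K A : Type*} [Field K] [AddCommGroup A] [Module K A]

lemma dual_dual_eq_eval [FiniteDimensional K A] (φ : Module.Dual K (Module.Dual K A)) :
    ∃ x, Module.Dual.eval K A x = φ :=
  (Module.evalEquiv K A).surjective φ

lemma pair₂_eval (x y : A) (t : Module.Dual K A ⊗[K] Module.Dual K A) :
    pair₂ (Module.Dual.eval K A x) (Module.Dual.eval K A y) t
      = TensorProduct.dualDistrib K A A t (x ⊗ₜ y) := by
  induction t using TensorProduct.induction_on with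
  | zero => simp
  | tmul a b => simp
  | add s t hs ht => simp [hs, ht]

lemma dualMap_dualMap_eval (f : A →ₗ[K] A) (x : A) :
    f.dualMap.dualMap (Module.Dual.eval K A x) = Module.Dual.eval K A (f x) := rfl

variable [FiniteDimensional K A]

lemma tensor_dual_ext {s t : Module.Dual K A ⊗[K] Module.Dual K A}
    (h : ∀ x y, pair₂ (Module.Dual.eval K A x) (Module.Dual.eval K A y) s
      = pair₂ (Module.Dual.eval K A x) (Module.Dual.eval K A y) t) : s = t := by
  refine tensor_ext fun φ ψ => ?_
  obtain ⟨x, rfl⟩ := dual_dual_eq_eval φ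
  obtain ⟨y, rfl⟩ := dual_dual_eq_eval ψ
  exact h x y

lemma pair₂_eval_dualCoop (m : A →ₗ[K] A →ₗ[K] A) (x y : A) (a : Module.Dual K A) :
    pair₂ (Module.Dual.eval K A x) (Module.Dual.eval K A y) (dualCoop m a) = -a (m x y) := by
  rw [pair₂_eval, dualCoop, LinearMap.neg_apply, map_neg, LinearMap.neg_apply]
  congr 1
  exact DFunLike.congr_fun ((TensorProduct.dualDistribEquiv K A A).apply_symm_apply
    ((TensorProduct.lift m).dualMap a)) (x ⊗ₜ y)

/-- The sign in `dualCoop` makes the bidual operation the negative of the original one. -/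
lemma dualOp_dualCoop (m : A →ₗ[K] A →ₗ[K] A) (x y : A) :
    dualOp (dualCoop m) (Module.Dual.eval K A x) (Module.Dual.eval K A y)
      = Module.Dual.eval K A (-m x y) := by
  ext a
  rw [dualOp_apply, pair₂_eval_dualCoop, map_neg, LinearMap.neg_apply, Module.Dual.eval_apply]

lemma apply_coactDual (m : Module.Dual K A →ₗ[K] Module.Dual K A →ₗ[K] Module.Dual K A)
    (a b : Module.Dual K A) (x : A) : b (coactDual m a x) = -m a b x := by
  have : Module.Dual.eval K A (coactDual m a x) = coact m a (Module.Dual.eval K A x) :=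
    (Module.evalEquiv K A).apply_symm_apply _
  exact DFunLike.congr_fun this b

lemma dualMap_eval (m : Module.Dual K A →ₗ[K] Module.Dual K A →ₗ[K] Module.Dual K A)
    (a : Module.Dual K A) (x : A) :
    (m a).dualMap (Module.Dual.eval K A x) = Module.Dual.eval K A (-coactDual m a x) := by
  ext b
  simp [apply_coactDual]

/-- The operations on `A**` dual to those on `A*` form a relative Poisson algebra. -/
lemma IsRelativePoissonAlgebra.double_dual {mul br : A →ₗ[K] A →ₗ[K] A} {P : A →ₗ[K] A}
    (h : IsRelativePoissonAlgebra mul br P) :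
    IsRelativePoissonAlgebra (dualOp (dualCoop mul)) (dualOp (dualCoop br)) P.dualMap.dualMap := by
  -- Product and bracket both change sign. Within each axiom all terms have the same total degree in
  -- the two operations, so the axioms survive.
  refine ⟨⟨fun φ ψ => ?_, fun φ ψ χ => ?_⟩, ⟨fun φ => ?_, fun φ ψ χ => ?_⟩, fun φ ψ => ?_,
    fun φ ψ => ?_, fun φ ψ χ => ?_⟩ <;> obtain ⟨x, rfl⟩ := dual_dual_eq_eval φ
  · obtain ⟨y, rfl⟩ := dual_dual_eq_eval ψ
    rw [dualOp_dualCoop, dualOp_dualCoop, h.commAssoc.comm]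
  · obtain ⟨y, rfl⟩ := dual_dual_eq_eval ψ
    obtain ⟨z, rfl⟩ := dual_dual_eq_eval χ
    simp only [dualOp_dualCoop, map_neg, LinearMap.neg_apply, h.commAssoc.assoc]
  · rw [dualOp_dualCoop, h.lie.self, neg_zero, map_zero]
  · obtain ⟨y, rfl⟩ := dual_dual_eq_eval ψ
    obtain ⟨z, rfl⟩ := dual_dual_eq_eval χ
    simp only [dualOp_dualCoop, map_neg, neg_neg, ← map_add, h.lie.jacobi, map_zero]
  · obtain ⟨y, rfl⟩ := dual_dual_eq_eval ψ
    simp only [dualOp_dualCoop, dualMap_dualMap_eval, ← map_add, map_neg, ← neg_add, h.map_mul]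
  · obtain ⟨y, rfl⟩ := dual_dual_eq_eval ψ
    simp only [dualOp_dualCoop, dualMap_dualMap_eval, ← map_add, map_neg, ← neg_add, h.map_br]
  · obtain ⟨y, rfl⟩ := dual_dual_eq_eval ψ
    obtain ⟨z, rfl⟩ := dual_dual_eq_eval χ
    simp only [dualOp_dualCoop, dualMap_dualMap_eval, map_neg, LinearMap.neg_apply, neg_neg,
      h.leibniz, map_add]

end DoubleDual

/-! ### The dual bialgebra. -/

section DualBialgebra

variable {K A : Type*} [Field K] [AddCommGroup A] [Module K A]
  [FiniteDimensional K A] {S : Operations K A}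

lemma IsRelativePoissonBialgebra.duallyRepresents_dual [CharZero K] (h : IsRelativePoissonBialgebra S) :
    DuallyRepresents S.dual.mul S.dual.br S.dual.P S.dual.Q := by
  have hd := h.coalgebra.dual
  refine ⟨fun a b => ?_, fun a b => ?_, fun a b c => ?_⟩ <;> ext x
  -- The functionals are exchanged because the codual condition has `P` on the first leg, whereas
  -- here `P*` acts on the second factor; commutativity of the dual product restores the order.
  · have := congrArg (pair₂ b a) (h.coDuallyRepresents.comul_map x)
    rw [map_sub, pair₂_rTensor, pair₂_lTensor] at this
    have h₁ := DFunLike.congr_fun (hd.commAssoc.comm a (S.P.dualMap b)) x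
    have h₂ := DFunLike.congr_fun (hd.commAssoc.comm (S.Q.dualMap a) b) x
    have h₃ := DFunLike.congr_fun (hd.commAssoc.comm a b) (S.P x)
    simp only [dualOp_apply] at h₁ h₂ h₃
    change pair₂ a (S.P.dualMap b) (S.Δ x) - pair₂ (S.Q.dualMap a) b (S.Δ x)
      - pair₂ a b (S.Δ (S.P x)) = 0
    linear_combination h₁ - h₂ - h₃ - this
  · have := congrArg (pair₂ b a) (h.coDuallyRepresents.cobr_map x)
    rw [map_sub, pair₂_rTensor, pair₂_lTensor] at this
    have h₁ := DFunLike.congr_fun (hd.lie.skew a (S.P.dualMap b)) x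
    have h₂ := DFunLike.congr_fun (hd.lie.skew (S.Q.dualMap a) b) x
    have h₃ := DFunLike.congr_fun (hd.lie.skew a b) (S.P x)
    simp only [dualOp_apply, LinearMap.neg_apply] at h₁ h₂ h₃
    change pair₂ a (S.P.dualMap b) (S.δ x) - pair₂ (S.Q.dualMap a) b (S.δ x)
      - pair₂ a b (S.δ (S.P x)) = 0
    linear_combination h₁ - h₂ - h₃ - -this
  · have := congrArg (pair₃ a b c) (h.coDuallyRepresents.add_map x)
    rw [pair₃_applyLeft, map_zero] at this
    change dualOp S.Δ (dualOp S.Δ a b) c (S.Q x) + dualOp S.Δ (dualOp S.Δ a b) c (S.P x) = 0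
    rw [← map_add, add_comm]
    exact this

lemma IsRelativePoissonBialgebra.coDuallyRepresents_dual (h : IsRelativePoissonBialgebra S) :
    CoDuallyRepresents S.dual.Δ S.dual.δ S.dual.P S.dual.Q := by
  have comm := h.algebra.commAssoc.comm
  have skew := h.algebra.lie.skew
  refine ⟨fun a => tensor_dual_ext fun x y => ?_, fun a => tensor_dual_ext fun x y => ?_,
    fun a => tensor_ext₃ fun φ ψ χ => ?_⟩
  · rw [map_sub, pair₂_rTensor, pair₂_lTensor]
    simp only [Operations.dual, dualMap_dualMap_eval, pair₂_eval_dualCoop,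
      LinearMap.dualMap_apply]
    have := congrArg a (h.duallyRepresents.mul_map y x)
    rw [comm y (S.Q x), comm (S.P y), comm y x] at this
    simp only [map_sub, map_zero] at this
    linear_combination this
  · rw [map_sub, pair₂_rTensor, pair₂_lTensor]
    simp only [Operations.dual, dualMap_dualMap_eval, pair₂_eval_dualCoop,
      LinearMap.dualMap_apply]
    have := congrArg a (h.duallyRepresents.br_map y x)
    rw [skew y (S.Q x), skew (S.P y), skew y x] at this
    simp only [map_sub, map_zero, map_neg] at this
    linear_combination -this
  · obtain ⟨x, rfl⟩ := dual_dual_eq_eval φ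
    obtain ⟨y, rfl⟩ := dual_dual_eq_eval ψ
    obtain ⟨z, rfl⟩ := dual_dual_eq_eval χ
    have := congrArg a (h.duallyRepresents.add_map x y z)
    rw [pair₃_applyLeft, map_zero]
    simp only [Operations.dual, dualOp_dualCoop, pair₂_eval_dualCoop, map_neg (S.mul),
      LinearMap.neg_apply, map_neg a, neg_neg, map_add, LinearMap.dualMap_apply, map_neg S.P,
      map_neg S.Q, LinearMap.add_apply]
    simp only [LinearMap.add_apply, map_add, map_zero] at this
    linear_combination this

/-- Evaluated at `x`, `y`, each mixed condition for `A*` is a scalar condition of `A` paired with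
`a`, `b`: the first two reproduce themselves and the last two are interchanged. -/
lemma IsRelativePoissonBialgebra.dual [CharZero K] (h : IsRelativePoissonBialgebra S) :
    IsRelativePoissonBialgebra S.dual := by
  have hd := h.coalgebra.dual
  have comm := h.algebra.commAssoc.comm
  have skew := h.algebra.lie.skew
  have mul_right (m) (a c : Module.Dual K A) (x y : A) :
      c (S.mul y (coactDual m a x)) = -m a ((S.mul y).dualMap c) x :=
    apply_coactDual m a ((S.mul y).dualMap c) x
  have mul_left (m) (a c : Module.Dual K A) (x y : A) :
      c (S.mul (coactDual m a x) y) = -m a ((S.mul y).dualMap c) x := by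
    rw [comm, mul_right]
  have br_right (m) (a c : Module.Dual K A) (x y : A) :
      c (S.br y (coactDual m a x)) = -m a ((S.br y).dualMap c) x :=
    apply_coactDual m a ((S.br y).dualMap c) x
  have br_left (m) (a c : Module.Dual K A) (x y : A) :
      c (S.br (coactDual m a x) y) = m a ((S.br y).dualMap c) x := by
    rw [skew, map_neg, br_right, neg_neg]
  have dual_comm (a b : Module.Dual K A) (x : A) : dualOp S.Δ a b x = dualOp S.Δ b a x :=
    DFunLike.congr_fun (hd.commAssoc.comm a b) x
  have dual_skew (a b : Module.Dual K A) (x : A) : dualOp S.δ a b x = -dualOp S.δ b a x :=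
    DFunLike.congr_fun (hd.lie.skew a b) x
  refine ⟨hd, .of_dual h.algebra.double_dual, fun a b => tensor_dual_ext fun x y => ?_,
    fun a b => tensor_dual_ext fun x y => ?_, h.duallyRepresents_dual, h.coDuallyRepresents_dual,
    fun a b => tensor_dual_ext fun x y => ?_, fun a b => tensor_dual_ext fun x y => ?_⟩
  · rw [map_add, pair₂_rTensor, pair₂_lTensor]
    simp only [Operations.dual, dualMap_eval, pair₂_eval_dualCoop]
    simp only [map_neg, LinearMap.neg_apply, mul_left, mul_right, dual_comm b]
    linear_combination -h.pair_comul_mul a b x y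
  · simp only [map_add, map_sub, pair₂_rTensor, pair₂_lTensor]
    simp only [Operations.dual, dualMap_eval, pair₂_eval_dualCoop]
    simp only [map_neg, LinearMap.neg_apply, br_left, br_right, dual_skew b]
    linear_combination -h.pair_cobr_br a b x y
  · simp only [map_sub, pair₂_rTensor, pair₂_lTensor]
    simp only [Operations.dual, dualMap_eval, pair₂_eval_dualCoop, dualMap_dualMap_eval]
    simp only [map_neg, LinearMap.neg_apply, br_left, mul_right, map_zero,
      skew x y, comm x (S.P y), dual_comm b, dual_skew b]
    linear_combination h.pair_comul_br a b y x
  · simp only [map_sub, map_add, pair₂_rTensor, pair₂_lTensor]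
    simp only [Operations.dual, dualMap_eval, pair₂_eval_dualCoop]
    simp only [map_neg, LinearMap.neg_apply, br_left, br_right, mul_left, mul_right, map_zero,
      dual_comm _ b, dual_skew a b]
    linear_combination h.pair_cobr_mul b a x y + dual_skew a ((S.mul x).dualMap b) y
      + dual_skew a ((S.mul y).dualMap b) x

end DualBialgebra

/-! ### Tensor operations commute with an intertwining map. -/

section Naturality

variable {K B V : Type*} [Field K] [AddCommGroup B] [Module K B] [AddCommGroup V] [Module K V]
  (i : B →ₗ[K] V)

open TensorProduct (map)

lemma flip_map (t : B ⊗[K] B) : flip (map i i t) = map i i (flip t) := by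
  induction t using TensorProduct.induction_on with
  | zero => simp
  | tmul x y => simp [flip]
  | add s t hs ht => simp [hs, ht]

lemma assoc_map_tmul (s : B ⊗[K] B) (z : B) :
    TensorProduct.assoc K V V V (map i i s ⊗ₜ i z)
      = map i (map i i) (TensorProduct.assoc K B B B (s ⊗ₜ z)) := by
  induction s using TensorProduct.induction_on with
  | zero => simp
  | tmul x y => simp
  | add s t hs ht => simp [TensorProduct.add_tmul, hs, ht]

lemma cyc_map (t : B ⊗[K] (B ⊗[K] B)) :
    cyc (map i (map i i) t) = map i (map i i) (cyc t) := by
  induction t using TensorProduct.induction_on with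
  | zero => simp
  | tmul x s => simp [cyc, assoc_map_tmul]
  | add s t hs ht => simp [hs, ht]

lemma flipLeft_map (t : B ⊗[K] (B ⊗[K] B)) :
    flipLeft (map i (map i i) t) = map i (map i i) (flipLeft t) := by
  induction t using TensorProduct.induction_on with
  | zero => simp
  | tmul x s =>
    induction s using TensorProduct.induction_on with
    | zero => simp
    | tmul y z => simp [flipLeft]
    | add s t hs ht => simp only [TensorProduct.tmul_add, map_add, hs, ht]
  | add s t hs ht => simp [hs, ht]

variable {i}

lemma rTensor_map {f : B →ₗ[K] B} {g : V →ₗ[K] V} (h : ∀ x, g (i x) = i (f x))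
    (t : B ⊗[K] B) : g.rTensor V (map i i t) = map i i (f.rTensor B t) := by
  induction t using TensorProduct.induction_on with
  | zero => simp
  | tmul x y => simp [h]
  | add s t hs ht => simp [hs, ht]

lemma lTensor_map {f : B →ₗ[K] B} {g : V →ₗ[K] V} (h : ∀ x, g (i x) = i (f x))
    (t : B ⊗[K] B) : g.lTensor V (map i i t) = map i i (f.lTensor B t) := by
  induction t using TensorProduct.induction_on with
  | zero => simp
  | tmul x y => simp [h]
  | add s t hs ht => simp [hs, ht]

lemma rTensor_map_map {f : B →ₗ[K] B} {g : V →ₗ[K] V} (h : ∀ x, g (i x) = i (f x))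
    (t : B ⊗[K] (B ⊗[K] B)) :
    g.rTensor (V ⊗[K] V) (map i (map i i) t) = map i (map i i) (f.rTensor (B ⊗[K] B) t) := by
  induction t using TensorProduct.induction_on with
  | zero => simp
  | tmul x y => simp [h]
  | add s t hs ht => simp [hs, ht]

lemma applyRight_map {Δ : B →ₗ[K] B ⊗[K] B} {Δ' : V →ₗ[K] V ⊗[K] V}
    (h : ∀ x, Δ' (i x) = map i i (Δ x)) (t : B ⊗[K] B) :
    applyRight Δ' (map i i t) = map i (map i i) (applyRight Δ t) := by
  induction t using TensorProduct.induction_on with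
  | zero => simp
  | tmul x y => simp [applyRight, h]
  | add s t hs ht => simp [hs, ht]

lemma applyLeft_map {Δ : B →ₗ[K] B ⊗[K] B} {Δ' : V →ₗ[K] V ⊗[K] V}
    (h : ∀ x, Δ' (i x) = map i i (Δ x)) (t : B ⊗[K] B) :
    applyLeft Δ' (map i i t) = map i (map i i) (applyLeft Δ t) := by
  induction t using TensorProduct.induction_on with
  | zero => simp
  | tmul x y => simp [applyLeft, h, assoc_map_tmul]
  | add s t hs ht => simp [hs, ht]

end Naturality

/-! ### Coalgebra axioms on a sum of two sub-bialgebras. -/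

section Sum

variable {K B C V : Type*} [Field K] [AddCommGroup B] [Module K B] [AddCommGroup C] [Module K C]
  [AddCommGroup V] [Module K V] {T : Operations K B} {U : Operations K C} {S : Operations K V}
  {i : B →ₗ[K] V} {j : C →ₗ[K] V}

/-- Every coalgebra axiom is linear in its single argument, so it may be checked on each summand,
where it is the image of an axiom already known. -/
lemma IsSubBialgebra.coalgebra_of_sum (hi : IsSubBialgebra T S i) (hj : IsSubBialgebra U S j)
    (hij : ∀ u, ∃ x y, u = i x + j y) (hT : IsRelativePoissonCoalgebra T.Δ T.δ T.Q)
    (hU : IsRelativePoissonCoalgebra U.Δ U.δ U.Q) : IsRelativePoissonCoalgebra S.Δ S.δ S.Q := by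
  refine ⟨⟨fun u => ?_, fun u => ?_⟩, ⟨fun u => ?_, fun u => ?_⟩, fun u => ?_, fun u => ?_,
    fun u => ?_⟩ <;> obtain ⟨x, y, rfl⟩ := hij u
  · simp only [map_add, hi.comul_eq, hj.comul_eq, flip_map, hT.cocommCoassoc.cocomm,
      hU.cocommCoassoc.cocomm]
  · simp only [map_add, hi.comul_eq, hj.comul_eq, applyRight_map hi.comul_eq,
      applyRight_map hj.comul_eq, applyLeft_map hi.comul_eq, applyLeft_map hj.comul_eq,
      hT.cocommCoassoc.coassoc, hU.cocommCoassoc.coassoc]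
  · simp only [map_add, hi.cobr_eq, hj.cobr_eq, flip_map, hT.lieCo.antisymm,
      hU.lieCo.antisymm, map_neg, neg_add]
  · have hx := congrArg (TensorProduct.map i (TensorProduct.map i i)) (hT.lieCo.cojacobi x)
    have hy := congrArg (TensorProduct.map j (TensorProduct.map j j)) (hU.lieCo.cojacobi y)
    simp only [map_add, map_zero] at hx hy
    simp only [map_add, hi.cobr_eq, hj.cobr_eq, applyRight_map hi.cobr_eq,
      applyRight_map hj.cobr_eq, cyc_map]
    linear_combination (norm := abel) hx + hy
  · simp only [map_add, hi.comul_eq, hj.comul_eq, hi.coderivation_eq, hj.coderivation_eq,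
      rTensor_map hi.coderivation_eq, rTensor_map hj.coderivation_eq,
      lTensor_map hi.coderivation_eq, lTensor_map hj.coderivation_eq, hT.comul_map, hU.comul_map]
    abel
  · simp only [map_add, hi.cobr_eq, hj.cobr_eq, hi.coderivation_eq, hj.coderivation_eq,
      rTensor_map hi.coderivation_eq, rTensor_map hj.coderivation_eq,
      lTensor_map hi.coderivation_eq, lTensor_map hj.coderivation_eq, hT.cobr_map, hU.cobr_map]
    abel
  · have hx := congrArg (TensorProduct.map i (TensorProduct.map i i)) (hT.coleibniz x)
    have hy := congrArg (TensorProduct.map j (TensorProduct.map j j)) (hU.coleibniz y)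
    simp only [map_sub, map_zero] at hx hy
    simp only [map_add, hi.cobr_eq, hj.cobr_eq, hi.comul_eq, hj.comul_eq,
      applyRight_map hi.cobr_eq, applyRight_map hj.cobr_eq, applyRight_map hi.comul_eq,
      applyRight_map hj.comul_eq, applyLeft_map hi.comul_eq, applyLeft_map hj.comul_eq,
      applyLeft_map hi.cobr_eq, applyLeft_map hj.cobr_eq, flipLeft_map,
      rTensor_map_map hi.coderivation_eq, rTensor_map_map hj.coderivation_eq]
    linear_combination (norm := abel) hx + hy

lemma IsSubBialgebra.coDuallyRepresents_of_sum (hi : IsSubBialgebra T S i)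
    (hj : IsSubBialgebra U S j) (hij : ∀ u, ∃ x y, u = i x + j y)
    (hT : CoDuallyRepresents T.Δ T.δ T.P T.Q) (hU : CoDuallyRepresents U.Δ U.δ U.P U.Q) :
    CoDuallyRepresents S.Δ S.δ S.P S.Q := by
  refine ⟨fun u => ?_, fun u => ?_, fun u => ?_⟩ <;> obtain ⟨x, y, rfl⟩ := hij u
  · simp only [map_add, hi.comul_eq, hj.comul_eq, hi.derivation_eq, hj.derivation_eq,
      rTensor_map hi.derivation_eq, rTensor_map hj.derivation_eq,
      lTensor_map hi.coderivation_eq, lTensor_map hj.coderivation_eq, hT.comul_map, hU.comul_map,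
      map_sub]
    abel
  · simp only [map_add, hi.cobr_eq, hj.cobr_eq, hi.derivation_eq, hj.derivation_eq,
      rTensor_map hi.derivation_eq, rTensor_map hj.derivation_eq,
      lTensor_map hi.coderivation_eq, lTensor_map hj.coderivation_eq, hT.cobr_map, hU.cobr_map,
      map_sub]
    abel
  · have hx : (S.P + S.Q) (i x) = i ((T.P + T.Q) x) := by
      simp [hi.derivation_eq, hi.coderivation_eq]
    have hy : (S.P + S.Q) (j y) = j ((U.P + U.Q) y) := by
      simp [hj.derivation_eq, hj.coderivation_eq]
    rw [map_add, hx, hy]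
    simp only [map_add S.Δ, map_add (applyLeft _), hi.comul_eq, hj.comul_eq,
      applyLeft_map hi.comul_eq, applyLeft_map hj.comul_eq, hT.add_map, hU.add_map, map_zero,
      add_zero]

end Sum

/-! ### The double and its canonical element. -/

section Double

variable {K A : Type*} [Field K] [AddCommGroup A] [Module K A]

lemma pair₂_map {B V : Type*} [AddCommGroup B] [Module K B] [AddCommGroup V] [Module K V]
    (i : B →ₗ[K] V) (φ ψ : Module.Dual K V) (t : B ⊗[K] B) :
    pair₂ φ ψ (TensorProduct.map i i t) = pair₂ (i.dualMap φ) (i.dualMap ψ) t := by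
  induction t using TensorProduct.induction_on with
  | zero => simp
  | tmul x y => simp
  | add s t hs ht => simp [hs, ht]

/-- The tensor encodes the identity of `A`: contracting it with `φ` returns the restriction of `φ`
to `A`. The right side does not involve `e`, so all bases give the same `r`. -/
lemma pair₂_basisTensor {n : ℕ} (e : Module.Basis (Fin n) K A)
    (φ ψ : Module.Dual K (A × Module.Dual K A)) :
    pair₂ φ ψ (basisTensor e) = ψ (0, (LinearMap.inl K A _).dualMap φ) := by
  have : (LinearMap.inl K A _).dualMap φ = ∑ i, φ (e i, 0) • e.coord i := by
    refine e.ext fun j => ?_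
    simp [Finsupp.single_apply, LinearMap.sum_apply]
  rw [← LinearMap.inr_apply (R := K), this, basisTensor, map_sum, map_sum, map_sum]
  exact Finset.sum_congr rfl fun i _ => by rw [map_smul, map_smul]; rfl

lemma inl_dualMap_coprod (a : Module.Dual K A) (φ : Module.Dual K (Module.Dual K A)) :
    (LinearMap.inl K A _).dualMap (a.coprod φ) = a := LinearMap.coprod_inl ..

lemma inr_dualMap_coprod (a : Module.Dual K A) (φ : Module.Dual K (Module.Dual K A)) :
    (LinearMap.inr K A _).dualMap (a.coprod φ) = φ := LinearMap.coprod_inr ..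

variable [FiniteDimensional K A]

/-- The operations on the double `A ⋈ A*`; as a coalgebra it is the direct sum of `A`
and `A*`. -/
noncomputable def Operations.double (S : Operations K A) :
    Operations K (A × Module.Dual K A) where
  mul := S.doubleMul
  br := S.doubleBr
  Δ := TensorProduct.map (.inl K A _) (.inl K A _) ∘ₗ S.Δ ∘ₗ .fst K A (Module.Dual K A)
    + TensorProduct.map (.inr K A _) (.inr K A _) ∘ₗ S.dual.Δ ∘ₗ .snd K A (Module.Dual K A)
  δ := TensorProduct.map (.inl K A _) (.inl K A _) ∘ₗ S.δ ∘ₗ .fst K A (Module.Dual K A)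
    + TensorProduct.map (.inr K A _) (.inr K A _) ∘ₗ S.dual.δ ∘ₗ .snd K A (Module.Dual K A)
  P := S.P.prodMap S.Q.dualMap
  Q := S.Q.prodMap S.P.dualMap

variable (S : Operations K A)

lemma double_mul_apply (x y : A) (a b : Module.Dual K A) :
    S.doubleMul (x, a) (y, b) =
      (S.mul x y - coactDual (dualOp S.Δ) a y - coactDual (dualOp S.Δ) b x,
        dualOp S.Δ a b + (S.mul x).dualMap b + (S.mul y).dualMap a) := by
  ext z <;> simp [Operations.doubleMul, matchedMul, coact, Operations.dual,
    sub_eq_add_neg, Module.Dual.transpose]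

lemma double_br_apply (x y : A) (a b : Module.Dual K A) :
    S.doubleBr (x, a) (y, b) =
      (S.br x y + coactDual (dualOp S.δ) a y - coactDual (dualOp S.δ) b x,
        dualOp S.δ a b - (S.br x).dualMap b + (S.br y).dualMap a) := by
  ext z <;> simp [Operations.doubleBr, matchedBr, coact, Operations.dual,
    sub_eq_add_neg, Module.Dual.transpose]

lemma isSubBialgebra_inl : IsSubBialgebra S S.double (.inl K A (Module.Dual K A)) where
  injective := LinearMap.inl_injective
  mul_eq x y := by simp [Operations.double, double_mul_apply]
  br_eq x y := by simp [Operations.double, double_br_apply]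
  comul_eq x := by simp [Operations.double]
  cobr_eq x := by simp [Operations.double]
  derivation_eq x := by simp [Operations.double]
  coderivation_eq x := by simp [Operations.double]

lemma isSubBialgebra_inr : IsSubBialgebra S.dual S.double (.inr K A (Module.Dual K A)) where
  injective := LinearMap.inr_injective
  mul_eq x y := by ext <;> simp [Operations.double, double_mul_apply, Operations.dual]
  br_eq x y := by ext <;> simp [Operations.double, double_br_apply, Operations.dual]
  comul_eq x := by simp [Operations.double]
  cobr_eq x := by simp [Operations.double]
  derivation_eq x := by simp [Operations.double, Operations.dual]
  coderivation_eq x := by simp [Operations.double, Operations.dual]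

lemma exists_eval_coprod (φ : Module.Dual K (A × Module.Dual K A)) :
    ∃ (a : Module.Dual K A) (x : A), φ = a.coprod (Module.Dual.eval K A x) := by
  obtain ⟨x, hx⟩ := dual_dual_eq_eval ((LinearMap.inr K A _).dualMap φ)
  refine ⟨(LinearMap.inl K A _).dualMap φ, x, ?_⟩
  rw [hx]
  ext <;> simp

/-- Contraction with `r` moves one operator onto a functional; the coadjoint parts of the double
product and bracket then give back the cooperations. The minus sign in `dualCoop` is what makes the
formulas hold on `A*`. -/
lemma isCoboundaryOf_basisTensor (h : IsRelativePoissonBialgebra S)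
    {n : ℕ} (e : Module.Basis (Fin n) K A) :
    IsCoboundaryOf S.double (basisTensor e) := by
  refine ⟨fun ⟨x, a⟩ => tensor_ext fun φ ψ => ?_, fun ⟨x, a⟩ => tensor_ext fun φ ψ => ?_⟩
  · obtain ⟨b, y, rfl⟩ := exists_eval_coprod φ
    obtain ⟨c, z, rfl⟩ := exists_eval_coprod ψ
    rw [map_sub, pair₂_lTensor, pair₂_rTensor, pair₂_basisTensor, pair₂_basisTensor]
    simp [Operations.double, pair₂_map, double_mul_apply, inl_dualMap_coprod, inr_dualMap_coprod,
      Operations.dual, apply_coactDual, ← dualOp_apply, dualOp_dualCoop]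
    rw [h.algebra.commAssoc.comm z y]
    ring
  · obtain ⟨b, y, rfl⟩ := exists_eval_coprod φ
    obtain ⟨c, z, rfl⟩ := exists_eval_coprod ψ
    rw [map_add, pair₂_lTensor, pair₂_rTensor, pair₂_basisTensor, pair₂_basisTensor]
    simp [Operations.double, pair₂_map, double_br_apply, inl_dualMap_coprod, inr_dualMap_coprod,
      Operations.dual, apply_coactDual, ← dualOp_apply, dualOp_dualCoop]
    rw [h.algebra.lie.skew z y, map_neg]
    ring

end Double

/-! ### Relative Poisson algebras with an invariant form. -/

section InvariantForm

variable {K V : Type*} [Field K] [AddCommGroup V] [Module K V]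

/-- `B` is a nondegenerate symmetric form which is invariant for the product and the bracket
of `S`, and for which `Q` is the adjoint of `P`. -/
structure IsInvariantForm (S : Operations K V) (B : V →ₗ[K] V →ₗ[K] K) : Prop where
  nondegenerate : ∀ u, (∀ v, B u v = 0) → u = 0
  symm : ∀ u v, B u v = B v u
  mul_assoc : ∀ u v w, B (S.mul u v) w = B u (S.mul v w)
  br_assoc : ∀ u v w, B (S.br u v) w = B u (S.br v w)
  adjoint : ∀ u v, B (S.P u) v = B u (S.Q v)

variable {S : Operations K V} {B : V →ₗ[K] V →ₗ[K] K}

lemma IsInvariantForm.ext (hB : IsInvariantForm S B) {u v : V} (h : ∀ w, B u w = B v w) :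
    u = v := by
  rw [← sub_eq_zero]
  exact hB.nondegenerate _ fun w => by rw [map_sub, LinearMap.sub_apply, h, sub_self]

/-- In the presence of an invariant form, the axioms of a relative Poisson algebra are symmetry
properties of quadrilinear forms. -/
lemma IsInvariantForm.isRelativePoissonAlgebra (hB : IsInvariantForm S B)
    (comm : ∀ u v, S.mul u v = S.mul v u) (self : ∀ u, S.br u u = 0)
    (skew : ∀ u v, S.br u v = -S.br v u)
    (assoc : ∀ u v w t, B (S.mul u v) (S.mul w t) = B (S.mul v w) (S.mul u t))
    (jacobi : ∀ u v w t, B (S.br u v) (S.br w t) - B (S.br u w) (S.br v t)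
      + B (S.br v w) (S.br u t) = 0)
    (map_mul : ∀ u v w, B (S.mul u v) (S.Q w) = B (S.P u) (S.mul v w) + B (S.P v) (S.mul u w))
    (map_br : ∀ u v w, B (S.br u v) (S.Q w) = B (S.P u) (S.br v w) - B (S.P v) (S.br u w))
    (leibniz : ∀ z u v w, B (S.br z u) (S.mul v w) + B (S.br z v) (S.mul u w)
      + B (S.br z w) (S.mul u v) + B (S.mul u v) (S.mul w (S.P z)) = 0) :
    IsRelativePoissonAlgebra S.mul S.br S.P := by
  refine ⟨⟨comm, fun u v w => hB.ext fun t => ?_⟩, ⟨self, fun u v w => hB.ext fun t => ?_⟩,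
    fun u v => hB.ext fun w => ?_, fun u v => hB.ext fun w => ?_, fun u v z => hB.ext fun w => ?_⟩
  · rw [comm u (S.mul v w), hB.mul_assoc (S.mul u v), hB.mul_assoc (S.mul v w)]
    exact assoc u v w t
  · rw [skew u (S.br v w), skew v (S.br w u), skew w (S.br u v), skew w u]
    simp only [map_add, map_neg, LinearMap.add_apply, LinearMap.neg_apply, hB.br_assoc (S.br _ _),
      map_zero, LinearMap.zero_apply]
    linear_combination -jacobi u v w t
  · rw [comm u (S.P v), map_add, LinearMap.add_apply, hB.adjoint, hB.mul_assoc (S.P u),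
      hB.mul_assoc (S.P v)]
    exact map_mul u v w
  · rw [skew u (S.P v), map_add, LinearMap.add_apply, hB.adjoint, map_neg, LinearMap.neg_apply,
      hB.br_assoc (S.P u), hB.br_assoc (S.P v)]
    linear_combination map_br u v w
  · rw [skew z (S.mul u v), comm u (S.br z v)]
    simp only [map_add, map_neg, LinearMap.add_apply, LinearMap.neg_apply, hB.br_assoc (S.mul _ _),
      hB.mul_assoc (S.br _ _), hB.mul_assoc (S.mul _ _)]
    rw [comm (S.P z) w, hB.symm (S.mul u v) (S.br z w)]
    linear_combination -leibniz z u v w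

/-- This is the Leibniz rule transposed in `z`: invariance moves `z` out of every term and `P`
becomes its adjoint `Q`. -/
lemma IsInvariantForm.br_mul (hB : IsInvariantForm S B)
    (hA : IsRelativePoissonAlgebra S.mul S.br S.P) (u v w : V) :
    S.br (S.mul u v) w = S.br u (S.mul v w) + S.br v (S.mul u w) + S.Q (S.mul (S.mul u v) w) := by
  refine hB.ext fun z => ?_
  have := congrArg (fun t => B t w) (hA.leibniz u v z)
  rw [hA.commAssoc.comm u (S.br z v)] at this
  simp only [map_add, LinearMap.add_apply] at this
  rw [hB.br_assoc z, hB.mul_assoc _ v, hB.mul_assoc _ u, hB.br_assoc z, hB.br_assoc z,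
    hA.commAssoc.comm _ (S.P z), hB.mul_assoc, hB.adjoint] at this
  simp only [map_add, LinearMap.add_apply]
  rw [hB.symm _ z, hB.symm _ z, hB.symm _ z, hB.symm _ z]
  exact this

/-- The first two conditions are the derivation rules of `P` transposed by the form. -/
lemma IsInvariantForm.duallyRepresents (hB : IsInvariantForm S B)
    (hA : IsRelativePoissonAlgebra S.mul S.br S.P) :
    DuallyRepresents S.mul S.br S.P S.Q := by
  have comm := hA.commAssoc.comm
  have skew := hA.lie.skew
  refine ⟨fun u v => hB.ext fun w => ?_, fun u v => hB.ext fun w => ?_, fun u v w => ?_⟩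
  · have := congrArg (B v) (hA.map_mul u w)
    simp only [map_sub, LinearMap.sub_apply, map_zero, LinearMap.zero_apply]
    rw [comm u (S.Q v), comm (S.P u), comm u v, hB.mul_assoc, hB.mul_assoc, hB.symm (S.Q v),
      hB.symm (S.Q _), ← hB.adjoint, ← hB.adjoint, hB.symm _ v, hB.symm _ (S.mul v u),
      hB.mul_assoc, this, map_add]
    ring
  · have := congrArg (B v) (hA.map_br u w)
    simp only [map_sub, LinearMap.sub_apply, map_zero, LinearMap.zero_apply]
    rw [skew u (S.Q v), skew (S.P u), skew u v]
    simp only [map_neg, LinearMap.neg_apply]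
    rw [hB.br_assoc, hB.br_assoc, hB.symm (S.Q v),
      hB.symm (S.Q _), ← hB.adjoint, ← hB.adjoint, hB.symm _ v, hB.symm _ (S.br v u),
      hB.br_assoc, this, map_add]
    ring
  · have h₁ := hB.br_mul hA u v w
    have h₂ := hA.leibniz u v w
    have h₃ := hA.leibniz v w u
    have h₄ := hA.leibniz u w v
    have e₁ : S.mul (S.br w u) v = -S.mul v (S.br u w) := by rw [comm, skew w u, map_neg]
    have e₂ : S.mul u (S.br w v) = -S.mul u (S.br v w) := by rw [skew w v, map_neg]
    have e₃ : S.mul (S.br v u) w = -S.mul (S.br u v) w := by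
      rw [skew v u, map_neg, LinearMap.neg_apply]
    have e₄ : S.mul (S.mul v w) (S.P u) = S.mul (S.mul (S.P u) v) w := by
      rw [comm, hA.commAssoc.assoc]
    have e₅ : S.mul (S.mul u w) (S.P v) = S.mul (S.mul u (S.P v)) w := by
      rw [hA.commAssoc.assoc, comm w, hA.commAssoc.assoc]
    have e₆ : S.P (S.mul (S.mul u v) w) = S.mul (S.mul (S.P u) v) w + S.mul (S.mul u (S.P v)) w
        + S.mul (S.mul u v) (S.P w) := by
      rw [hA.map_mul, hA.map_mul, map_add, LinearMap.add_apply]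
    rw [skew, h₂, h₃, h₄, e₁, e₂, e₃, e₄, e₅] at h₁
    rw [LinearMap.add_apply, e₆]
    linear_combination (norm := module) -h₁

end InvariantForm

/-! ### Compatibility conditions for coboundary structures. -/

section Coboundary

variable {K V : Type*} [Field K] [AddCommGroup V] [Module K V] {S : Operations K V}

/-- The compatibility conditions of a relative Poisson bialgebra hold for the coboundaries of `r`
if `(P ⊗ id) r = (id ⊗ Q) r`. -/
lemma IsCoboundaryOf.isRelativePoissonBialgebra {r : V ⊗[K] V} (hr : IsCoboundaryOf S r)
    (hPQ : S.P.rTensor V r = S.Q.lTensor V r)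
    (hA : IsRelativePoissonAlgebra S.mul S.br S.P)
    (hC : IsRelativePoissonCoalgebra S.Δ S.δ S.Q)
    (hD : DuallyRepresents S.mul S.br S.P S.Q) (hD' : CoDuallyRepresents S.Δ S.δ S.P S.Q)
    (br_mul : ∀ u v w, S.br (S.mul u v) w
      = S.br u (S.mul v w) + S.br v (S.mul u w) + S.Q (S.mul (S.mul u v) w)) :
    IsRelativePoissonBialgebra S := by
  have mul_mul (u v : V) : S.mul (S.mul u v) = S.mul u ∘ₗ S.mul v :=
    LinearMap.ext fun w => hA.commAssoc.assoc u v w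
  have mul_mul' (u v : V) : S.mul (S.mul u v) = S.mul v ∘ₗ S.mul u := by
    rw [hA.commAssoc.comm, mul_mul]
  have br_br (u v : V) : S.br (S.br u v) = S.br u ∘ₗ S.br v - S.br v ∘ₗ S.br u := by
    ext w
    have := hA.lie.jacobi u v w
    rw [hA.lie.skew w (S.br u v), hA.lie.skew w u, map_neg] at this
    simp only [LinearMap.sub_apply, LinearMap.comp_apply]
    linear_combination (norm := module) -this
  have br_mul_left (u v : V) : S.br (S.mul u v) = S.mul u ∘ₗ S.br v + S.mul v ∘ₗ S.br u
      - S.mul (S.mul u v) ∘ₗ S.P := by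
    ext w
    have := hA.leibniz u v w
    rw [hA.lie.skew w (S.mul u v), hA.lie.skew w u, hA.lie.skew w v, map_neg, map_neg,
      LinearMap.neg_apply, hA.commAssoc.comm (S.br u w) v] at this
    simp only [LinearMap.sub_apply, LinearMap.comp_apply, LinearMap.add_apply]
    linear_combination (norm := module) -this
  -- There are two expansions of `ad(uv)`: the one with `P` serves the first leg of `r`, this one
  -- with `Q` the second.
  have br_mul_right (u v : V) : S.br (S.mul u v) = S.br u ∘ₗ S.mul v + S.br v ∘ₗ S.mul u
      + S.Q ∘ₗ S.mul (S.mul u v) := LinearMap.ext (br_mul u v)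
  have mul_br (u v : V) : S.mul (S.br u v) = S.br u ∘ₗ S.mul v - S.mul v ∘ₗ S.br u
      - S.mul (S.mul (S.P u) v) := by
    ext w
    have := hA.leibniz v w u
    rw [hA.commAssoc.comm _ (S.P u), ← hA.commAssoc.assoc] at this
    simp only [LinearMap.sub_apply, LinearMap.comp_apply]
    linear_combination (norm := module) -this
  have swap (f g : V →ₗ[K] V) (t : V ⊗[K] V) :
      f.rTensor V (g.lTensor V t) = g.lTensor V (f.rTensor V t) := by
    rw [← LinearMap.comp_apply, ← LinearMap.comp_apply, LinearMap.rTensor_comp_lTensor,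
      LinearMap.lTensor_comp_rTensor]
  refine ⟨hA, hC, fun u v => ?_, fun u v => ?_, hD, hD', fun u v => ?_, fun u v => ?_⟩
  · simp only [hr.comul_eq, map_sub, swap]
    -- The two legs need opposite orders of `L(u)` and `L(v)`; the cross terms `L(u) ⊗ L(v)` then
    -- cancel.
    nth_rw 1 [mul_mul']
    rw [mul_mul]
    simp only [LinearMap.lTensor_comp, LinearMap.rTensor_comp, LinearMap.comp_apply]
    abel
  · simp only [hr.cobr_eq, map_add, swap, br_br]
    simp only [LinearMap.lTensor_sub, LinearMap.rTensor_sub, LinearMap.lTensor_comp,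
      LinearMap.rTensor_comp, LinearMap.comp_apply, LinearMap.sub_apply]
    abel
  -- This matches the `P` term from the first leg of `δ(uv)` with the `L(uv) ⊗ Q` part of `(id ⊗ Q)
  -- Δ(uv)`.
  · have hPQ' : (S.mul (S.mul u v)).rTensor V (S.P.rTensor V r)
        = S.Q.lTensor V ((S.mul (S.mul u v)).rTensor V r) := by rw [hPQ, swap]
    rw [hr.cobr_eq]
    nth_rw 1 [br_mul_left]
    rw [br_mul_right]
    simp only [hr.comul_eq, hr.cobr_eq, map_add, map_sub, swap]
    simp only [LinearMap.rTensor_sub, LinearMap.lTensor_add, LinearMap.rTensor_add, LinearMap.lTensor_comp,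
      LinearMap.rTensor_comp, LinearMap.comp_apply, LinearMap.sub_apply, LinearMap.add_apply, hPQ']
    abel
  · simp only [hr.comul_eq, hr.cobr_eq, map_add, map_sub, swap, mul_br]
    simp only [LinearMap.lTensor_sub, LinearMap.rTensor_sub, LinearMap.lTensor_comp,
      LinearMap.rTensor_comp, LinearMap.comp_apply, LinearMap.sub_apply]
    abel

end Coboundary

/-! ### The algebra axioms of the double, component by component. -/

section DoubleForm

variable {K A : Type*} [Field K] [AddCommGroup A] [Module K A]

variable (K A) in
/-- The symmetric form `(x + a, y + b) ↦ ⟨b, x⟩ + ⟨a, y⟩` on `A ⊕ A*`. -/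
def doubleForm : (A × Module.Dual K A) →ₗ[K] (A × Module.Dual K A) →ₗ[K] K :=
  LinearMap.mk₂ K (fun u v => v.2 u.1 + u.2 v.1)
    (fun u u' v => by simp; ring) (fun c u v => by simp; ring)
    (fun u v v' => by simp; ring) (fun c u v => by simp; ring)

lemma doubleForm_apply (x y : A) (a b : Module.Dual K A) :
    doubleForm K A (x, a) (y, b) = b x + a y := rfl

variable [FiniteDimensional K A] {S : Operations K A}

/-- The mixed products of the double are transposes of multiplications, which is exactly invariance
of this form. -/
lemma IsRelativePoissonBialgebra.isInvariantForm [CharZero K]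
    (h : IsRelativePoissonBialgebra S) : IsInvariantForm S.double (doubleForm K A) := by
  have hd := h.coalgebra.dual
  have comm := h.algebra.commAssoc.comm
  have skew := h.algebra.lie.skew
  have dual_comm (a b : Module.Dual K A) (x : A) : dualOp S.Δ a b x = dualOp S.Δ b a x :=
    DFunLike.congr_fun (hd.commAssoc.comm a b) x
  have dual_skew (a b : Module.Dual K A) (x : A) : dualOp S.δ a b x = -dualOp S.δ b a x :=
    DFunLike.congr_fun (hd.lie.skew a b) x
  refine ⟨fun ⟨x, a⟩ hu => ?_, fun ⟨x, a⟩ ⟨y, b⟩ => ?_, fun ⟨x, a⟩ ⟨y, b⟩ ⟨z, c⟩ => ?_,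
    fun ⟨x, a⟩ ⟨y, b⟩ ⟨z, c⟩ => ?_, fun ⟨x, a⟩ ⟨y, b⟩ => ?_⟩
  · have hx : x = 0 := (Module.forall_dual_apply_eq_zero_iff K x).mp fun b => by
      simpa [doubleForm_apply] using hu (0, b)
    have ha : a = 0 := LinearMap.ext fun y => by simpa [doubleForm_apply] using hu (y, 0)
    rw [hx, ha, Prod.mk_zero_zero]
  · simp only [doubleForm_apply]
    ring
  · simp only [Operations.double, double_mul_apply, doubleForm_apply, map_sub,
      apply_coactDual, LinearMap.add_apply, LinearMap.dualMap_apply]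
    rw [comm y x, comm z x, dual_comm a c, dual_comm b c, dual_comm b a]
    ring
  · simp only [Operations.double, double_br_apply, doubleForm_apply, map_add, map_sub,
      apply_coactDual, LinearMap.add_apply, LinearMap.sub_apply, LinearMap.dualMap_apply]
    rw [skew y x, skew z x, dual_skew c a, dual_skew b a, map_neg, map_neg]
    ring
  · simp only [Operations.double, LinearMap.prodMap_apply, doubleForm_apply,
      LinearMap.dualMap_apply]

/-- Components with three arguments on one side are associativity of `A` or `A*`; those with two on
each side come from the infinitesimal condition. -/
lemma IsRelativePoissonBialgebra.double_mul_assoc [CharZero K]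
    (h : IsRelativePoissonBialgebra S) (u v w t : A × Module.Dual K A) :
    doubleForm K A (S.double.mul u v) (S.double.mul w t)
      = doubleForm K A (S.double.mul v w) (S.double.mul u t) := by
  obtain ⟨x, a⟩ := u
  obtain ⟨y, b⟩ := v
  obtain ⟨z, c⟩ := w
  obtain ⟨s, d⟩ := t
  have hd := h.coalgebra.dual
  have comm := h.algebra.commAssoc.comm
  have assoc := h.algebra.commAssoc.assoc
  have left_comm (x y z : A) : S.mul x (S.mul y z) = S.mul y (S.mul x z) := by
    rw [← assoc, comm x, assoc]
  have comm' := hd.commAssoc.comm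
  have assoc' := hd.commAssoc.assoc
  have left_comm' (a b c : Module.Dual K A) :
      dualOp S.Δ a (dualOp S.Δ b c) = dualOp S.Δ b (dualOp S.Δ a c) := by
    rw [← assoc', comm' a, assoc']
  have h₁ := h.pair_comul_mul d c x y
  have h₂ := h.pair_comul_mul b a z s
  have h₃ := h.pair_comul_mul a d y z
  have h₄ := h.pair_comul_mul b c x s
  -- When `u` and `w` lie on the same side, no single instance suffices: two instances with
  -- exchanged functionals share their left side and are subtracted.
  have h₅ := h.pair_comul_mul b d x z
  have h₆ := h.pair_comul_mul d b x z
  have h₇ := h.pair_comul_mul a c y s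
  have h₈ := h.pair_comul_mul c a y s
  simp only [Operations.double, double_mul_apply, doubleForm_apply, map_sub,
    apply_coactDual, LinearMap.add_apply]
  simp only [LinearMap.dualMap_apply, comm, left_comm, comm', left_comm']
    at h₁ h₂ h₃ h₄ h₅ h₆ h₇ h₈ ⊢
  linear_combination h₁ + h₂ - h₃ - h₄ + h₆ - h₅ + h₈ - h₇

/-- The six ways of taking two arguments from `A` give the cocycle condition; the three-to-one
components are the Jacobi identities of `A` and `A*`. -/
lemma IsRelativePoissonBialgebra.double_br_jacobi [CharZero K]
    (h : IsRelativePoissonBialgebra S) (u v w t : A × Module.Dual K A) :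
    doubleForm K A (S.double.br u v) (S.double.br w t)
      - doubleForm K A (S.double.br u w) (S.double.br v t)
      + doubleForm K A (S.double.br v w) (S.double.br u t) = 0 := by
  obtain ⟨x, a⟩ := u
  obtain ⟨y, b⟩ := v
  obtain ⟨z, c⟩ := w
  obtain ⟨s, d⟩ := t
  have hd := h.coalgebra.dual
  have dual_skew (a b : Module.Dual K A) (x y : A) :
      dualOp S.δ ((S.br x).dualMap a) b y = -dualOp S.δ b ((S.br x).dualMap a) y :=
    DFunLike.congr_fun (hd.lie.skew _ b) y
  have J (a : Module.Dual K A) (x y z : A) :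
      a (S.br x (S.br y z)) - a (S.br y (S.br x z)) + a (S.br z (S.br x y)) = 0 := by
    have := congrArg a (h.algebra.lie.jacobi x y z)
    rw [h.algebra.lie.skew z x] at this
    simp only [map_add, map_neg, map_zero] at this
    linear_combination this
  have J' (a b c : Module.Dual K A) (x : A) :
      dualOp S.δ a (dualOp S.δ b c) x - dualOp S.δ b (dualOp S.δ a c) x
        + dualOp S.δ c (dualOp S.δ a b) x = 0 := by
    have := DFunLike.congr_fun (hd.lie.jacobi a b c) x
    rw [hd.lie.skew c a] at this
    simp only [map_neg, LinearMap.add_apply, LinearMap.neg_apply, LinearMap.zero_apply] at this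
    linear_combination this
  have h₁ := h.pair_cobr_br c d x y
  have h₂ := h.pair_cobr_br b d x z
  have h₃ := h.pair_cobr_br b c x s
  have h₄ := h.pair_cobr_br a d y z
  have h₅ := h.pair_cobr_br a c y s
  have h₆ := h.pair_cobr_br a b z s
  simp only [Operations.double, double_br_apply, doubleForm_apply, map_add, map_sub,
    apply_coactDual, LinearMap.add_apply, LinearMap.sub_apply]
  simp only [LinearMap.dualMap_apply, dual_skew] at h₁ h₂ h₃ h₄ h₅ h₆ ⊢
  linear_combination h₁ - h₂ + h₃ + h₄ - h₅ + h₆ - J d x y z + J c x y s - J b x z s + J a y z s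
    - J' a b c s + J' a b d z - J' a c d y + J' b c d x

/-- The components are the derivation rule when `w` alone lies on its side, and a dual
representation condition when `u` or `v` does. -/
lemma IsRelativePoissonBialgebra.double_map_mul [CharZero K]
    (h : IsRelativePoissonBialgebra S) (u v w : A × Module.Dual K A) :
    doubleForm K A (S.double.mul u v) (S.double.Q w)
      = doubleForm K A (S.double.P u) (S.double.mul v w)
        + doubleForm K A (S.double.P v) (S.double.mul u w) := by
  obtain ⟨x, a⟩ := u
  obtain ⟨y, b⟩ := v
  obtain ⟨z, c⟩ := w
  have hd := h.coalgebra.dual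
  have comm := h.algebra.commAssoc.comm
  have comm' := hd.commAssoc.comm
  have h₁ := congrArg c (h.algebra.map_mul x y)
  have h₂ := congrArg b (h.duallyRepresents.mul_map x z)
  have h₃ := congrArg a (h.duallyRepresents.mul_map y z)
  have h₄ := DFunLike.congr_fun (hd.map_mul a b) z
  have h₅ := DFunLike.congr_fun (h.duallyRepresents_dual.mul_map a c) y
  have h₆ := DFunLike.congr_fun (h.duallyRepresents_dual.mul_map b c) x
  simp only [Operations.double, double_mul_apply, doubleForm_apply, map_add, map_sub,
    apply_coactDual, LinearMap.add_apply, LinearMap.sub_apply, LinearMap.prodMap_apply,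
    Operations.dual, map_zero, LinearMap.zero_apply] at h₁ h₂ h₃ h₄ h₅ h₆ ⊢
  simp only [LinearMap.dualMap_apply, comm, comm'] at h₁ h₂ h₃ h₄ h₅ h₆ ⊢
  linear_combination h₁ + h₂ + h₃ + h₄ + h₅ + h₆

lemma IsRelativePoissonBialgebra.double_map_br [CharZero K]
    (h : IsRelativePoissonBialgebra S) (u v w : A × Module.Dual K A) :
    doubleForm K A (S.double.br u v) (S.double.Q w)
      = doubleForm K A (S.double.P u) (S.double.br v w)
        - doubleForm K A (S.double.P v) (S.double.br u w) := by
  obtain ⟨x, a⟩ := u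
  obtain ⟨y, b⟩ := v
  obtain ⟨z, c⟩ := w
  have hd := h.coalgebra.dual
  have skew (a : Module.Dual K A) (x y : A) : a (S.br (S.P x) y) = -a (S.br y (S.P x)) := by
    rw [h.algebra.lie.skew, map_neg]
  have dual_skew (a b : Module.Dual K A) (x : A) :
      dualOp S.δ (S.Q.dualMap a) b x = -dualOp S.δ b (S.Q.dualMap a) x :=
    DFunLike.congr_fun (hd.lie.skew _ b) x
  have h₁ := congrArg c (h.algebra.map_br x y)
  have h₂ := congrArg b (h.duallyRepresents.br_map x z)
  have h₃ := congrArg a (h.duallyRepresents.br_map y z)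
  have h₄ := DFunLike.congr_fun (hd.map_br a b) z
  have h₅ := DFunLike.congr_fun (h.duallyRepresents_dual.br_map a c) y
  have h₆ := DFunLike.congr_fun (h.duallyRepresents_dual.br_map b c) x
  simp only [Operations.double, double_br_apply, doubleForm_apply, map_add, map_sub,
    apply_coactDual, LinearMap.add_apply, LinearMap.sub_apply, LinearMap.prodMap_apply,
    Operations.dual, map_zero, LinearMap.zero_apply] at h₁ h₂ h₃ h₄ h₅ h₆ ⊢
  simp only [LinearMap.dualMap_apply, skew, dual_skew] at h₁ h₂ h₃ h₄ h₅ h₆ ⊢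
  linear_combination h₁ - h₂ + h₃ + h₄ - h₅ + h₆

/-- In the sum of the three Leibniz expansions the brackets cancel in pairs and `P(uvw)` remains,
which is `-Q(uvw)`. It supplies the components of the double's Leibniz rule in which `t` alone lies
on its side. -/
lemma DuallyRepresents.cyclic_leibniz {V : Type*} [AddCommGroup V] [Module K V]
    {mul br : V →ₗ[K] V →ₗ[K] V} {P Q : V →ₗ[K] V}
    (hD : DuallyRepresents mul br P Q) (hA : IsRelativePoissonAlgebra mul br P) (u v w : V) :
    br u (mul v w) + br v (mul u w) + br w (mul u v) + Q (mul (mul u v) w) = 0 := by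
  have comm := hA.commAssoc.comm
  have skew := hA.lie.skew
  have e₁ : mul (br w u) v = -mul v (br u w) := by rw [comm, skew w u, map_neg]
  have e₂ : mul u (br w v) = -mul u (br v w) := by rw [skew w v, map_neg]
  have e₃ : mul (br v u) w = -mul (br u v) w := by
    rw [skew v u, map_neg, LinearMap.neg_apply]
  have e₄ : mul (mul v w) (P u) = mul (mul (P u) v) w := by
    rw [comm, hA.commAssoc.assoc]
  have e₅ : mul (mul u w) (P v) = mul (mul u (P v)) w := by
    rw [hA.commAssoc.assoc, comm w, hA.commAssoc.assoc]
  have e₆ : P (mul (mul u v) w) = mul (mul (P u) v) w + mul (mul u (P v)) w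
      + mul (mul u v) (P w) := by
    rw [hA.map_mul, hA.map_mul, map_add, LinearMap.add_apply]
  have e₇ := hD.add_map u v w
  rw [LinearMap.add_apply, e₆] at e₇
  rw [hA.leibniz, hA.leibniz, hA.leibniz, e₁, e₂, e₃, e₄, e₅]
  linear_combination (norm := module) e₇

set_option maxHeartbeats 1000000 in
lemma IsRelativePoissonBialgebra.double_leibniz [CharZero K]
    (h : IsRelativePoissonBialgebra S) (t u v w : A × Module.Dual K A) :
    doubleForm K A (S.double.br t u) (S.double.mul v w)
      + doubleForm K A (S.double.br t v) (S.double.mul u w)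
      + doubleForm K A (S.double.br t w) (S.double.mul u v)
      + doubleForm K A (S.double.mul u v) (S.double.mul w (S.double.P t)) = 0 := by
  obtain ⟨s, d⟩ := t
  obtain ⟨x, a⟩ := u
  obtain ⟨y, b⟩ := v
  obtain ⟨z, c⟩ := w
  have hd := h.coalgebra.dual
  have comm := h.algebra.commAssoc.comm
  have assoc := h.algebra.commAssoc.assoc
  have left_comm (x y z : A) : S.mul x (S.mul y z) = S.mul y (S.mul x z) := by
    rw [← assoc, comm x, assoc]
  have comm' := hd.commAssoc.comm
  have assoc' := hd.commAssoc.assoc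
  have left_comm' (a b c : Module.Dual K A) :
      dualOp S.Δ a (dualOp S.Δ b c) = dualOp S.Δ b (dualOp S.Δ a c) := by
    rw [← assoc', comm' a, assoc']
  have dual_skew₀ (a : Module.Dual K A) (x : A) : dualOp S.δ d a x = -dualOp S.δ a d x :=
    DFunLike.congr_fun (hd.lie.skew d a) x
  have dual_skew (a b : Module.Dual K A) (x y : A) :
      dualOp S.δ ((S.mul x).dualMap a) b y = -dualOp S.δ b ((S.mul x).dualMap a) y :=
    DFunLike.congr_fun (hd.lie.skew _ b) y
  have h₁ := congrArg d (h.duallyRepresents.cyclic_leibniz h.algebra x y z)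
  have h₂ := congrArg c (h.algebra.leibniz x y s)
  have h₃ := congrArg b (h.algebra.leibniz x z s)
  have h₄ := congrArg a (h.algebra.leibniz y z s)
  -- `h₁` and `h₅` have `t` alone on its side; `h₂`–`h₄` and `h₆`–`h₈` have one of `u`, `v`, `w`
  -- alone.
  have h₅ := DFunLike.congr_fun (h.duallyRepresents_dual.cyclic_leibniz hd a b c) s
  have h₆ := DFunLike.congr_fun (hd.leibniz a b d) z
  have h₇ := DFunLike.congr_fun (hd.leibniz a c d) y
  have h₈ := DFunLike.congr_fun (hd.leibniz b c d) x
  -- From here on two arguments lie on each side. The mixed condition is `cobr_mul` for `t` in `A*`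
  -- and `comul_br` for `t` in `A`.
  have h₉ := h.pair_cobr_mul c d x y
  have h₁₀ := h.pair_cobr_mul b d x z
  have h₁₁ := h.pair_cobr_mul a d y z
  have h₁₂ := h.pair_comul_br a b s z
  have h₁₃ := h.pair_comul_br a c s y
  have h₁₄ := h.pair_comul_br b c s x
  -- The last four instances adjust the `Q` and `P` terms, which the mixed conditions contain as a
  -- coproduct of a product.
  have h₁₅ := h.pair_comul_mul a (S.Q.dualMap d) y z
  have h₁₆ := h.pair_comul_mul b (S.Q.dualMap d) x z
  have h₁₇ := h.pair_comul_mul a c y (S.P s)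
  have h₁₈ := h.pair_comul_mul b c x (S.P s)
  simp only [Operations.double, double_br_apply, double_mul_apply, doubleForm_apply, map_add,
    map_sub, apply_coactDual, LinearMap.add_apply, LinearMap.sub_apply, LinearMap.prodMap_apply,
    Operations.dual, map_zero, LinearMap.zero_apply]
    at h₁ h₂ h₃ h₄ h₅ h₆ h₇ h₈ h₉ h₁₀ h₁₁ h₁₂ h₁₃ h₁₄ h₁₅ h₁₆ h₁₇ h₁₈ ⊢
  simp only [LinearMap.dualMap_apply, comm, left_comm, comm', left_comm', dual_skew]
    at h₁ h₂ h₃ h₄ h₅ h₆ h₇ h₈ h₉ h₁₀ h₁₁ h₁₂ h₁₃ h₁₄ h₁₅ h₁₆ h₁₇ h₁₈ ⊢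
  linear_combination h₁ - h₂ - h₃ - h₄ + h₅ - h₆ - h₇ - h₈ - h₉ - h₁₀ - h₁₁ + h₁₂ + h₁₃ + h₁₄
    - h₁₅ - h₁₆ - h₁₇ - h₁₈ + dual_skew₀ a (S.mul y z) + dual_skew₀ b (S.mul x z)
    + dual_skew₀ c (S.mul x y)

lemma IsRelativePoissonBialgebra.double_isRelativePoissonAlgebra [CharZero K]
    (h : IsRelativePoissonBialgebra S) :
    IsRelativePoissonAlgebra S.double.mul S.double.br S.double.P := by
  have hd := h.coalgebra.dual
  refine h.isInvariantForm.isRelativePoissonAlgebra (fun ⟨x, a⟩ ⟨y, b⟩ => ?_) (fun ⟨x, a⟩ => ?_)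
    (fun ⟨x, a⟩ ⟨y, b⟩ => ?_) h.double_mul_assoc h.double_br_jacobi h.double_map_mul
    h.double_map_br h.double_leibniz
  · simp only [Operations.double, double_mul_apply, h.algebra.commAssoc.comm y,
      hd.commAssoc.comm b]
    ext <;> simp <;> abel
  · simp only [Operations.double, double_br_apply, h.algebra.lie.self, hd.lie.self]
    ext <;> simp
  · simp only [Operations.double, double_br_apply, h.algebra.lie.skew y, hd.lie.skew b]
    ext <;> simp <;> abel

lemma IsRelativePoissonBialgebra.isRelativePoissonBialgebra_double [CharZero K]
    (h : IsRelativePoissonBialgebra S) : IsRelativePoissonBialgebra S.double := by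
  have hA := h.double_isRelativePoissonAlgebra
  have hi := isSubBialgebra_inl S
  have hj := isSubBialgebra_inr S
  have hij (u : A × Module.Dual K A) : ∃ x a, u = LinearMap.inl K A _ x + LinearMap.inr K A _ a :=
    ⟨u.1, u.2, by simp⟩
  refine (isCoboundaryOf_basisTensor S h (Module.finBasis K A)).isRelativePoissonBialgebra
    (tensor_ext fun φ ψ => ?_) hA
    (hi.coalgebra_of_sum hj hij h.coalgebra h.dual.coalgebra)
    (h.isInvariantForm.duallyRepresents hA)
    (hi.coDuallyRepresents_of_sum hj hij h.coDuallyRepresents h.dual.coDuallyRepresents)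
    (h.isInvariantForm.br_mul hA)
  -- The identity left is `∑ P eᵢ ⊗ eᵢ* = ∑ eᵢ ⊗ P* eᵢ*`, the definition of the transpose.
  rw [pair₂_rTensor, pair₂_lTensor, pair₂_basisTensor, pair₂_basisTensor]
  refine congrArg ψ (Prod.ext ?_ (LinearMap.ext fun x => ?_)) <;> simp [Operations.double]

end DoubleForm

end RelPoisson

theorem theorem4p4 {K A : Type*} [Field K] [IsAlgClosed K] [CharZero K]
    [AddCommGroup A] [Module K A] [FiniteDimensional K A]
    (S : RelPoisson.Operations K A) (hS : RelPoisson.IsRelativePoissonBialgebra S) :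
    RelPoisson.IsRelativePoissonBialgebra S.dual ∧
    ∃ D : RelPoisson.Operations K (A × Module.Dual K A),
      RelPoisson.IsCoboundaryRelativePoissonBialgebra D ∧
      D.mul = S.doubleMul ∧
      D.br = S.doubleBr ∧
      D.P = S.P.prodMap S.Q.dualMap ∧
      D.Q = S.Q.prodMap S.P.dualMap ∧
      (∀ (n : ℕ) (e : Module.Basis (Fin n) K A),
        RelPoisson.IsCoboundaryOf D (RelPoisson.basisTensor e)) ∧
      RelPoisson.IsSubBialgebra S D (LinearMap.inl K A (Module.Dual K A)) ∧
      RelPoisson.IsSubBialgebra S.dual D (LinearMap.inr K A (Module.Dual K A)) :=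
  ⟨hS.dual, S.double, ⟨hS.isRelativePoissonBialgebra_double, _,
    RelPoisson.isCoboundaryOf_basisTensor S hS (Module.finBasis K A)⟩, rfl, rfl, rfl, rfl,
    fun _ e => RelPoisson.isCoboundaryOf_basisTensor S hS e,
    RelPoisson.isSubBialgebra_inl S, RelPoisson.isSubBialgebra_inr S⟩
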